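/- Let $d\ge 0$ be an integer. For $z=(x,\xi)\in\mathbb R^{n}\times\mathbb R^n$ let $\rho(z)F(t)=e^{-\pi i x\cdot\xi}e^{2\pi i\xi\cdot t}F(t-x)$ on $L^2(\mathbb R^n)$. A metaplectic operator with projection $\mathcal A\in Sp(n,\mathbb R)$ is a unitary operator $\mu(\mathcal A)$ on $L^2(\mathbb R^n)$ with $\mu(\mathcal A)\rho(z)\mu(\mathcal A)^{-1}=\rho(\mathcal A z)$ for all $z\in\mathbb R^{2n}$; it is determined by $\mathcal A$ up to a constant factor of modulus one. For $\mathcal A\in Sp(2d,\mathbb R)$ (so $n=2d$) and a choice of $\mu(\mathcal A)$, the metaplectic Wigner distribution is $W_{\mathcal A}(f,g)=\mu(\mathcal A)(f\otimes\bar g)$, where $(f\otimes \bar g)(x,y)=f(x)\overline{g(y)}$, and the cross-Wigner distribution is $$W(f,g)(x,\xi)=\int_{\mathbb R^d} f\big(x+\tfrac t2\big)\overline{g\big(x-\tfrac t2\big)}e^{-2\pi i t\cdot\xi}\,dt .$$ **Theorem.** Let $\mathcal A\in Sp(2d,\mathbb R)$ be a covariant matrix, i.e. $$\mathcal A=\begin{pmatrix}A_{11}&I-A_{11}&A_{13}&A_{13}\\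 A_{21}&-A_{21}&I-A_{11}^T&-A_{11}^T\\ 0&0&I&I\\ -I&I&0&0\end{pmatrix}$$ with $d\times d$ real blocks, $A_{13}=A_{13}^T$ and $A_{21}=A_{21}^T$. Put $$B_{\mathcal A}=\begin{pmatrix}A_{13}&\tfrac12 I-A_{11}\\ \tfrac12 I-A_{11}^T&-A_{21}\end{pmatrix},\qquad \Sigma_{\mathcal A}=\mathcal F^{-1}\big(e^{-\pi i\,\zeta\cdot B_{\mathcal A}\zeta}\big)\in\mathcal S'(\mathbb R^{2d}),$$ where $\hat f(\xi)=\int f(t)e^{-2\pi i\xi\cdot t}\,dt$. Then, for a suitable choice of the phase of $\mu(\mathcal A)$, for all $f,g\in\mathcal S(\mathbb R^d)$ the function $W(f,g)$ lies in $\mathcal S(\mathbb R^{2d})$ and $$W_{\mathcal A}(f,g)=W(f,g)*\Sigma_{\mathcal A}.$$ For an arbitrary choice of $\mu(\mathcal A)$ there is a constant $c\in\mathbb C$ with $|c|=1$, independent of $f$ and $g$, such that $c\,W_{\mathcal A}(f,g)=W(f,g)*\Sigma_{\mathcal A}$ for all $f,g\in\mathcal S(\mathbb R^d)$. In particular $W_{\mathcal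 A}$ belongs to the Cohen class: there is $\Sigma\in\mathcal S'(\mathbb R^{2d})$ with $W_{\mathcal A}(f,g)=W(f,g)*\Sigma$ for all $f,g\in\mathcal S(\mathbb R^d)$. -/

import Mathlib

open MeasureTheory SchwartzMap FourierTransform Matrix
open scoped ENNReal ComplexConjugate

noncomputable section

namespace CohenKernel

variable {ι : Type*} [Fintype ι]

/-- The space `ℝ^ι` with its Euclidean structure and Lebesgue measure. With `ι = Fin d` this is
`ℝ^d`; `Vec (ι ⊕ ι)` is the corresponding doubled space `ℝ^{2d}`. -/
abbrev Vec (ι : Type*) : Type _ := EuclideanSpace ℝ ι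

/-- `L²(ℝ^ι)`. -/
abbrev L2 (ι : Type*) [Fintype ι] : Type _ := Lp ℂ 2 (volume : Measure (Vec ι))

/-- The component `x` of `(x, ξ)`. -/
def fstPart (z : Vec (ι ⊕ ι)) : Vec ι := WithLp.toLp 2 fun i => z (Sum.inl i)

/-- The component `ξ` of `(x, ξ)`. -/
def sndPart (z : Vec (ι ⊕ ι)) : Vec ι := WithLp.toLp 2 fun i => z (Sum.inr i)

/-- The linear action of a matrix on column vectors. -/
def act (A : Matrix ι ι ℝ) (z : Vec ι) : Vec ι := WithLp.toLp 2 (A *ᵥ z.ofLp)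

/-! ### The Schrödinger representation and metaplectic operators -/

/-- The symmetric time-frequency shift
`ρ(x, ξ) F (t) = e^{-πi x·ξ} e^{2πi ξ·t} F(t - x)`, that is `e^{-πi x·ξ} M_ξ T_x F`. -/
def shiftFun (z : Vec (ι ⊕ ι)) (F : Vec ι → ℂ) (t : Vec ι) : ℂ :=
  Complex.exp (-(Real.pi * Complex.I * (inner ℝ (fstPart z) (sndPart z) : ℝ))) *
    Complex.exp (2 * Real.pi * Complex.I * (inner ℝ (sndPart z) t : ℝ)) * F (t - fstPart z)

theorem memLp_shiftFun (z : Vec (ι ⊕ ι)) {F : Vec ι → ℂ} (hF : MemLp F 2 volume) :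
    MemLp (shiftFun z F) 2 volume := by
  have h1 : MemLp (fun t => F (t - fstPart z)) 2 volume :=
    hF.comp_measurePreserving (measurePreserving_sub_right volume (fstPart z))
  refine h1.of_le (AEStronglyMeasurable.mul (Continuous.aestronglyMeasurable (by fun_prop)) h1.1)
    (Filter.Eventually.of_forall fun t => ?_)
  simp [shiftFun, Complex.norm_exp]

/-- The Schrödinger representation `ρ(z)` on `L²(ℝ^ι)`. -/
def schrodinger (z : Vec (ι ⊕ ι)) (F : L2 ι) : L2 ι :=
  (memLp_shiftFun z (Lp.memLp F)).toLp (shiftFun z F)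

/-- `U` is a metaplectic operator `μ(A)` with projection `A`: a unitary operator on `L²(ℝ^ι)`
with `U ρ(z) U⁻¹ = ρ(A z)` for all `z`. This fixes `U` up to a constant phase factor. -/
def IsMetaplectic (A : Matrix (ι ⊕ ι) (ι ⊕ ι) ℝ) (U : L2 ι ≃ₗᵢ[ℂ] L2 ι) : Prop :=
  ∀ (z : Vec (ι ⊕ ι)) (F : L2 ι), U (schrodinger z F) = schrodinger (act A z) (U F)

/-! ### Metaplectic Wigner distributions -/

/-- Lebesgue measure on `ℝ^ι × ℝ^ι` is preserved by the identification `z ↦ (x, ξ)`. -/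
theorem measurePreserving_parts :
    MeasurePreserving (fun z : Vec (ι ⊕ ι) => (fstPart z, sndPart z)) volume
      (volume.prod volume) := by
  have h1 := PiLp.volume_preserving_ofLp (ι ⊕ ι)
  have h2 := measurePreserving_sumPiEquivProdPi (ι := ι) (ι' := ι)
    (X := fun _ => ℝ) (fun _ => (volume : Measure ℝ))
  have h3 := (PiLp.volume_preserving_toLp ι).prod (PiLp.volume_preserving_toLp ι)
  exact h3.comp (h2.comp h1)

/-- `(F ⊗ Ḡ)(x, y) = F(x) conj(G(y))`. -/
def tensorFun (F G : Vec ι → ℂ) (z : Vec (ι ⊕ ι)) : ℂ := F (fstPart z) * conj (G (sndPart z))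

theorem memLp_tensorFun {F G : Vec ι → ℂ} (hF : MemLp F 2 volume) (hG : MemLp G 2 volume) :
    MemLp (tensorFun F G) 2 volume := by
  have hm : AEStronglyMeasurable (fun p : Vec ι × Vec ι => F p.1 * conj (G p.2))
      (volume.prod volume) :=
    (hF.1.comp_fst).mul (Complex.continuous_conj.comp_aestronglyMeasurable hG.1.comp_snd)
  have hp : MemLp (fun p : Vec ι × Vec ι => F p.1 * conj (G p.2)) 2 (volume.prod volume) := by
    rw [memLp_two_iff_integrable_sq_norm hm]
    have := ((memLp_two_iff_integrable_sq_norm hF.1).1 hF).mul_prod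
      ((memLp_two_iff_integrable_sq_norm hG.1).1 hG)
    refine this.congr (Filter.Eventually.of_forall fun p => ?_)
    simp [mul_pow]
  exact hp.comp_measurePreserving measurePreserving_parts

/-- `f ⊗ ḡ` as an element of `L²(ℝ^{2d})`. -/
def tensorConj (f g : L2 ι) : L2 (ι ⊕ ι) :=
  (memLp_tensorFun (Lp.memLp f) (Lp.memLp g)).toLp (tensorFun f g)

/-- The metaplectic Wigner distribution `W_A(f, g) = μ(A)(f ⊗ ḡ)`, with `U` in the role of
`μ(A)`. -/
def metaWigner (U : L2 (ι ⊕ ι) ≃ₗᵢ[ℂ] L2 (ι ⊕ ι)) (f g : L2 ι) : L2 (ι ⊕ ι) :=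
  U (tensorConj f g)

/-- The cross-Wigner distribution
`W(f, g)(x, ξ) = ∫ f(x + t/2) conj(g(x - t/2)) e^{-2πi t·ξ} dt`. -/
def wigner (f g : Vec ι → ℂ) (z : Vec (ι ⊕ ι)) : ℂ :=
  ∫ t : Vec ι, f (fstPart z + (2⁻¹ : ℝ) • t) * conj (g (fstPart z - (2⁻¹ : ℝ) • t)) *
    Complex.exp (-(2 * Real.pi * Complex.I * (inner ℝ t (sndPart z) : ℝ)))

/-! ### Convolution with a tempered distribution and the Cohen class -/

/-- The reflected translate `y ↦ w(z - y)` of a Schwartz function. -/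
def reflectTranslate (w : 𝓢(Vec ι, ℂ)) (z : Vec ι) : 𝓢(Vec ι, ℂ) :=
  SchwartzMap.compCLMOfContinuousLinearEquiv ℂ (ContinuousLinearEquiv.neg ℝ)
    (SchwartzMap.compSubConstCLM ℂ (-z) w)

theorem reflectTranslate_apply (w : 𝓢(Vec ι, ℂ)) (z y : Vec ι) :
    reflectTranslate w z y = w (z - y) := by
  simp [reflectTranslate, sub_eq_add_neg, add_comm]

/-- The convolution `w ∗ S` of a Schwartz function with a tempered distribution, which is the
function `z ↦ S(w(z - ·))`. -/
def conv (w : 𝓢(Vec ι, ℂ)) (S : 𝓢'(Vec ι, ℂ)) (z : Vec ι) : ℂ := S (reflectTranslate w z)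

/-- `Q(f, g) = W(f, g) ∗ S` for all Schwartz functions `f, g`, including the claim that `W(f, g)`
is a Schwartz function, so that the convolution makes sense. -/
def IsWignerConv (Q : 𝓢(Vec ι, ℂ) → 𝓢(Vec ι, ℂ) → L2 (ι ⊕ ι)) (S : 𝓢'(Vec (ι ⊕ ι), ℂ)) : Prop :=
  ∀ f g : 𝓢(Vec ι, ℂ), ∃ w : 𝓢(Vec (ι ⊕ ι), ℂ),
    (∀ z, w z = wigner f g z) ∧ Q f g =ᵐ[volume] conv w S

/-- The Cohen class: `Q(f, g) = W(f, g) ∗ S` for some tempered distribution `S`. -/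
def IsCohenClass (Q : 𝓢(Vec ι, ℂ) → 𝓢(Vec ι, ℂ) → L2 (ι ⊕ ι)) : Prop :=
  ∃ S : 𝓢'(Vec (ι ⊕ ι), ℂ), IsWignerConv Q S

/-- The bounded function `ζ ↦ e^{-πi ζ·Bζ}`. -/
def phase (B : Matrix ι ι ℝ) (ζ : Vec ι) : ℂ :=
  Complex.exp (-(Real.pi * Complex.I * (inner ℝ ζ (act B ζ) : ℝ)))

theorem memLp_phase (B : Matrix ι ι ℝ) : MemLp (phase B) ∞ volume := by
  refine memLp_top_of_bound (Continuous.aestronglyMeasurable ?_) 1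
    (Filter.Eventually.of_forall fun ζ => ?_)
  · unfold phase act
    fun_prop
  · simp [phase, Complex.norm_exp]

/-- The tempered distribution `φ ↦ ∫ φ(ζ) e^{-πi ζ·Bζ} dζ`. -/
def phaseDistribution (B : Matrix ι ι ℝ) : 𝓢'(Vec ι, ℂ) :=
  Lp.toTemperedDistribution ((memLp_phase B).toLp (phase B))

theorem phaseDistribution_apply (B : Matrix ι ι ℝ) (φ : 𝓢(Vec ι, ℂ)) :
    phaseDistribution B φ = ∫ ζ, φ ζ * phase B ζ := by
  rw [phaseDistribution, Lp.toTemperedDistribution_apply]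
  refine integral_congr_ae ?_
  filter_upwards [(memLp_phase B).coeFn_toLp] with ζ h
  rw [h, smul_eq_mul]

/-! ### Covariant matrices -/

section Covariant

variable [DecidableEq ι]

/-- The `4d × 4d` matrix with rows of blocks
`(A₁₁, I - A₁₁, A₁₃, A₁₃)`, `(A₂₁, -A₂₁, I - A₁₁ᵀ, -A₁₁ᵀ)`, `(0, 0, I, I)`, `(-I, I, 0, 0)`. -/
def covariantMatrix (A11 A13 A21 : Matrix ι ι ℝ) :
    Matrix ((ι ⊕ ι) ⊕ (ι ⊕ ι)) ((ι ⊕ ι) ⊕ (ι ⊕ ι)) ℝ :=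
  Matrix.fromBlocks
    (Matrix.fromBlocks A11 (1 - A11) A21 (-A21))
    (Matrix.fromBlocks A13 A13 (1 - A11ᵀ) (-A11ᵀ))
    (Matrix.fromBlocks 0 0 (-1) 1)
    (Matrix.fromBlocks 1 1 0 0)

/-- The symmetric matrix `B_A` with rows of blocks
`(A₁₃, ½I - A₁₁)`, `(½I - A₁₁ᵀ, -A₂₁)`. -/
def cohenMatrix (A11 A13 A21 : Matrix ι ι ℝ) : Matrix (ι ⊕ ι) (ι ⊕ ι) ℝ :=
  Matrix.fromBlocks A13 ((2⁻¹ : ℝ) • (1 : Matrix ι ι ℝ) - A11)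
    ((2⁻¹ : ℝ) • (1 : Matrix ι ι ℝ) - A11ᵀ) (-A21)

/-- The kernel `Σ_A = 𝓕⁻¹(e^{-πi ζ·B_A ζ})`, a tempered distribution on `ℝ^{2d}`. -/
def cohenKernel (A11 A13 A21 : Matrix ι ι ℝ) : 𝓢'(Vec (ι ⊕ ι), ℂ) :=
  𝓕⁻ (phaseDistribution (cohenMatrix A11 A13 A21))

end Covariant

end CohenKernel

end

noncomputable section

namespace CohenKernel

variable {ι : Type*} [Fintype ι]

/-! ### Metaplectic operators form a group -/

/-! The shape of a covariant matrix is exactly what makes `μ(A)` a Fourier multiplier applied after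
the Wigner transform. Let `A₀` be the covariant matrix with `A₁₁ = ½I` and `A₁₃ = A₂₁ = 0`. Then `A`
is the upper triangular block matrix `(I, B; 0, I)` times `A₀`, where `B = B_A`. The operator over
`A₀` sends `f ⊗ ḡ` to `W(f, g)`. The operator over `(I, B; 0, I)` is the Fourier conjugate of
multiplication by the chirp `e^{-πi ζ·Bζ}`, hence convolution with `Σ_A`. Projections multiply under
composition, so the product is one admissible `μ(A)` (`isMetaplectic_cohenOp`,
`isWignerConv_cohenOp`).

The Wigner transform is a determinant `±1` change of variables followed by a Fourier transform in
the second variable. From `-2ξ·t = -|ξ|² + |ξ - t|² - |t|²`, this partial transform is a chirp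
multiplication, a convolution with a chirp and another chirp multiplication. The convolution is a
chirp Fourier multiplier up to the constant `i^{d/2}`. Thus only chirps, full Fourier transforms and
linear substitutions are needed, and each has an explicit projection and preserves Schwartz
functions.

Any other choice of `μ(A)` differs by a unimodular constant, by Schur's lemma
(`exists_eq_smul_of_commute`): an operator commuting with modulations is a multiplication operator,
and commuting with translations makes its symbol constant. -/

@[simp] theorem act_apply (A : Matrix ι ι ℝ) (z : Vec ι) (i : ι) : act A z i = (A *ᵥ z.ofLp) i :=
  rfl

theorem act_act (A B : Matrix ι ι ℝ) (z : Vec ι) : act A (act B z) = act (A * B) z := by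
  simp [act, Matrix.mulVec_mulVec]

theorem act_one [DecidableEq ι] (z : Vec ι) : act (1 : Matrix ι ι ℝ) z = z := by
  simp [act]

theorem fstPart_act_fromBlocks (A B C D : Matrix ι ι ℝ) (z : Vec (ι ⊕ ι)) :
    fstPart (act (fromBlocks A B C D) z) = act A (fstPart z) + act B (sndPart z) := by
  ext i
  simp [fstPart, sndPart, act, Matrix.fromBlocks_mulVec, Function.comp_def]

theorem sndPart_act_fromBlocks (A B C D : Matrix ι ι ℝ) (z : Vec (ι ⊕ ι)) :
    sndPart (act (fromBlocks A B C D) z) = act C (fstPart z) + act D (sndPart z) := by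
  ext i
  simp [fstPart, sndPart, act, Matrix.fromBlocks_mulVec, Function.comp_def]

theorem act_zero_matrix (z : Vec ι) : act (0 : Matrix ι ι ℝ) z = 0 := by
  ext i; simp

theorem act_neg_matrix (A : Matrix ι ι ℝ) (z : Vec ι) : act (-A) z = -act A z := by
  ext i; simp [Matrix.neg_mulVec]

theorem act_sub (A : Matrix ι ι ℝ) (z w : Vec ι) : act A (z - w) = act A z - act A w := by
  ext i; simp [Matrix.mulVec_sub]

theorem inner_act_left (A : Matrix ι ι ℝ) (x y : Vec ι) :
    inner ℝ (act A x) y = inner ℝ x (act Aᵀ y) := by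
  simp only [act, EuclideanSpace.inner_eq_star_dotProduct, star_trivial]
  rw [Matrix.mulVec_transpose, Matrix.dotProduct_mulVec, dotProduct_comm, dotProduct_comm]

theorem inner_eq_inner_parts (z w : Vec (ι ⊕ ι)) :
    inner ℝ z w = inner ℝ (fstPart z) (fstPart w) + inner ℝ (sndPart z) (sndPart w) := by
  simp [fstPart, sndPart, PiLp.inner_apply, Fintype.sum_sum_type]

theorem coeFn_schrodinger (z : Vec (ι ⊕ ι)) (F : L2 ι) :
    schrodinger z F =ᵐ[volume] shiftFun z F :=
  MemLp.coeFn_toLp _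

theorem shiftFun_congr_ae (z : Vec (ι ⊕ ι)) {F G : Vec ι → ℂ} (h : F =ᵐ[volume] G) :
    shiftFun z F =ᵐ[volume] shiftFun z G := by
  have := (measurePreserving_sub_right (volume : Measure (Vec ι))
    (fstPart z)).quasiMeasurePreserving.ae_eq_comp h
  filter_upwards [this] with t ht
  simp only [Function.comp_apply] at ht
  simp only [shiftFun, ht]

theorem norm_shiftFun (z : Vec (ι ⊕ ι)) (F : Vec ι → ℂ) (t : Vec ι) :
    ‖shiftFun z F t‖ = ‖F (t - fstPart z)‖ := by
  simp [shiftFun, Complex.norm_exp]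

variable (ι) in
/-- The Schrödinger representation acts by linear isometries. -/
def schrodingerIsometry (z : Vec (ι ⊕ ι)) : L2 ι →ₗᵢ[ℂ] L2 ι where
  toFun := schrodinger z
  map_add' F G := by
    apply Lp.ext
    filter_upwards [coeFn_schrodinger z (F + G), coeFn_schrodinger z F, coeFn_schrodinger z G,
      Lp.coeFn_add (schrodinger z F) (schrodinger z G),
      shiftFun_congr_ae z (Lp.coeFn_add F G)] with t h1 h2 h3 h4 h5
    rw [h1, h4, h5]
    simp only [Pi.add_apply, h2, h3, shiftFun]
    ring
  map_smul' c F := by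
    apply Lp.ext
    filter_upwards [coeFn_schrodinger z (c • F), coeFn_schrodinger z F,
      Lp.coeFn_smul c (schrodinger z F), shiftFun_congr_ae z (Lp.coeFn_smul c F)] with t h1 h2 h4 h5
    simp only [RingHom.id_apply]
    rw [h1, h4, h5]
    simp only [Pi.smul_apply, h2, shiftFun, smul_eq_mul]
    ring
  norm_map' F := by
    change ‖schrodinger z F‖ = ‖F‖
    have h1 : ‖schrodinger z F‖ = (eLpNorm (shiftFun z F) 2 volume).toReal := Lp.norm_toLp _ _
    rw [h1, Lp.norm_def]
    congr 1
    rw [← eLpNorm_comp_measurePreserving (Lp.aestronglyMeasurable F)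
      (measurePreserving_sub_right (volume : Measure (Vec ι)) (fstPart z))]
    exact eLpNorm_congr_norm_ae (Filter.Eventually.of_forall fun t => norm_shiftFun z F t)

theorem continuous_schrodinger (z : Vec (ι ⊕ ι)) : Continuous (schrodinger z : L2 ι → L2 ι) :=
  (schrodingerIsometry ι z).continuous

theorem schrodinger_smul (z : Vec (ι ⊕ ι)) (c : ℂ) (F : L2 ι) :
    schrodinger z (c • F) = c • schrodinger z F :=
  (schrodingerIsometry ι z).map_smul c F

/-- `U.trans V` applies `U` first, whence the order of the matrix product. -/
theorem IsMetaplectic.trans {A B : Matrix (ι ⊕ ι) (ι ⊕ ι) ℝ} {U V : L2 ι ≃ₗᵢ[ℂ] L2 ι}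
    (hU : IsMetaplectic A U) (hV : IsMetaplectic B V) : IsMetaplectic (B * A) (U.trans V) := by
  intro z F
  simp only [LinearIsometryEquiv.trans_apply]
  rw [hU, hV, act_act]

theorem IsMetaplectic.symm [DecidableEq ι] {A B : Matrix (ι ⊕ ι) (ι ⊕ ι) ℝ}
    {U : L2 ι ≃ₗᵢ[ℂ] L2 ι} (hU : IsMetaplectic A U) (h : A * B = 1) : IsMetaplectic B U.symm := by
  intro z F
  rw [LinearIsometryEquiv.symm_apply_eq, hU, act_act, h, act_one, U.apply_symm_apply]

/-- Multiplication by a constant of modulus one. -/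
def constMul (c : ℂ) (hc : ‖c‖ = 1) : L2 ι ≃ₗᵢ[ℂ] L2 ι where
  toLinearEquiv := LinearEquiv.smulOfNeZero ℂ (L2 ι) c (by rintro rfl; simp at hc)
  norm_map' F := by simp [norm_smul, hc]

theorem constMul_apply (c : ℂ) (hc : ‖c‖ = 1) (F : L2 ι) : constMul c hc F = c • F := rfl

theorem isMetaplectic_constMul [DecidableEq ι] (c : ℂ) (hc : ‖c‖ = 1) :
    IsMetaplectic (1 : Matrix (ι ⊕ ι) (ι ⊕ ι) ℝ) (constMul (ι := ι) c hc) := by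
  intro z F
  rw [constMul_apply, constMul_apply, act_one, schrodinger_smul]

/-! ### Multiplication by a chirp -/

theorem norm_phase (B : Matrix ι ι ℝ) (ζ : Vec ι) : ‖phase B ζ‖ = 1 := by
  simp [phase, Complex.norm_exp]

theorem continuous_phase (B : Matrix ι ι ℝ) : Continuous (phase B) := by
  unfold phase act
  fun_prop

theorem phase_mul_phase_neg (B : Matrix ι ι ℝ) (ζ : Vec ι) : phase B ζ * phase (-B) ζ = 1 := by
  rw [phase, phase, ← Complex.exp_add, act_neg_matrix, inner_neg_right]
  simp

theorem memLp_phase_mul (B : Matrix ι ι ℝ) {F : Vec ι → ℂ} (hF : MemLp F 2 volume) :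
    MemLp (fun t => phase B t * F t) 2 volume :=
  hF.of_le ((continuous_phase B).aestronglyMeasurable.mul hF.1)
    (Filter.Eventually.of_forall fun t => by simp [norm_phase])

/-- Multiplication by `phase B` as a map on `L²`. -/
def phaseMulFun (B : Matrix ι ι ℝ) (F : L2 ι) : L2 ι := (memLp_phase_mul B (Lp.memLp F)).toLp _

theorem coeFn_phaseMulFun (B : Matrix ι ι ℝ) (F : L2 ι) :
    phaseMulFun B F =ᵐ[volume] fun t => phase B t * F t :=
  MemLp.coeFn_toLp _

theorem phaseMulFun_phaseMulFun_neg (B : Matrix ι ι ℝ) (F : L2 ι) :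
    phaseMulFun B (phaseMulFun (-B) F) = F := by
  apply Lp.ext
  filter_upwards [coeFn_phaseMulFun B (phaseMulFun (-B) F), coeFn_phaseMulFun (-B) F]
    with t h1 h2
  rw [h1, h2, ← mul_assoc, phase_mul_phase_neg, one_mul]

/-- Multiplication by the chirp `phase B` as a unitary operator. -/
def phaseMul (B : Matrix ι ι ℝ) : L2 ι ≃ₗᵢ[ℂ] L2 ι where
  toFun := phaseMulFun B
  invFun := phaseMulFun (-B)
  left_inv F := by simpa using phaseMulFun_phaseMulFun_neg (-B) F
  right_inv F := phaseMulFun_phaseMulFun_neg B F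
  map_add' F G := by
    apply Lp.ext
    filter_upwards [coeFn_phaseMulFun B (F + G), coeFn_phaseMulFun B F, coeFn_phaseMulFun B G,
      Lp.coeFn_add (phaseMulFun B F) (phaseMulFun B G), Lp.coeFn_add F G] with t h1 h2 h3 h4 h5
    rw [h1, h4, h5]
    simp only [Pi.add_apply, h2, h3]
    ring
  map_smul' c F := by
    apply Lp.ext
    filter_upwards [coeFn_phaseMulFun B (c • F), coeFn_phaseMulFun B F,
      Lp.coeFn_smul c (phaseMulFun B F), Lp.coeFn_smul c F] with t h1 h2 h4 h5
    simp only [RingHom.id_apply]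
    rw [h1, h4, h5]
    simp only [Pi.smul_apply, h2, smul_eq_mul]
    ring
  norm_map' F := by
    change ‖phaseMulFun B F‖ = ‖F‖
    have h1 : ‖phaseMulFun B F‖ = (eLpNorm (fun t => phase B t * F t) 2 volume).toReal :=
      Lp.norm_toLp _ _
    rw [h1, Lp.norm_def]
    congr 1
    exact eLpNorm_congr_norm_ae (Filter.Eventually.of_forall fun t => by simp [norm_phase])

theorem coeFn_phaseMul (B : Matrix ι ι ℝ) (F : L2 ι) :
    phaseMul B F =ᵐ[volume] fun t => phase B t * F t :=
  coeFn_phaseMulFun B F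

/-- With `x = fstPart z`, symmetry of `B` gives `t·Bt = (t - x)·B(t - x) + 2t·Bx - x·Bx`. Moving the
chirp past the translation therefore produces a modulation by `-Bx`, and the leftover constant is
the change in the symmetric factor `e^{-πi x·ξ}`. -/
theorem isMetaplectic_phaseMul [DecidableEq ι] (B : Matrix ι ι ℝ) (hB : Bᵀ = B) :
    IsMetaplectic (fromBlocks 1 0 (-B) 1) (phaseMul B) := by
  intro z F
  have h0 := (measurePreserving_sub_right (volume : Measure (Vec ι))
    (fstPart z)).quasiMeasurePreserving.ae_eq_comp (coeFn_phaseMul B F)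
  apply Lp.ext
  filter_upwards [coeFn_phaseMul B (schrodinger z F), coeFn_schrodinger z F,
    coeFn_schrodinger (act (fromBlocks 1 0 (-B) 1) z) (phaseMul B F), h0] with t h1 h2 h3 h4
  rw [h1, h2, h3]
  simp only [Function.comp_apply] at h4
  simp only [shiftFun, fstPart_act_fromBlocks, sndPart_act_fromBlocks, act_one, act_zero_matrix,
    add_zero, h4, act_neg_matrix, phase]
  have hs : inner ℝ (fstPart z) (act B t) = inner ℝ t (act B (fstPart z)) := by
    rw [real_inner_comm, inner_act_left, hB]
  have hs' : inner ℝ (act B (fstPart z)) t = inner ℝ t (act B (fstPart z)) := real_inner_comm _ _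
  simp only [← Complex.exp_add, ← mul_assoc]
  congr 2
  simp only [act_sub, inner_sub_left, inner_sub_right, inner_add_left, inner_add_right,
    inner_neg_left, inner_neg_right, hs, hs']
  push_cast
  ring

/-! ### Linear changes of variables -/

/-- The linear action of a matrix as a continuous linear map. -/
def actCLM (M : Matrix ι ι ℝ) : Vec ι →L[ℝ] Vec ι :=
  LinearMap.toContinuousLinearMap
    { toFun := act M
      map_add' := fun x y => by ext i; simp [Matrix.mulVec_add]
      map_smul' := fun c x => by ext i; simp [Matrix.mulVec_smul] }

theorem actCLM_apply (M : Matrix ι ι ℝ) (x : Vec ι) : actCLM M x = act M x := rfl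

theorem measurePreserving_act [DecidableEq ι] (M : Matrix ι ι ℝ) (hM : |M.det| = 1) :
    MeasurePreserving (act M) (volume : Measure (Vec ι)) volume := by
  have h1 := PiLp.volume_preserving_ofLp ι
  have h3 := PiLp.volume_preserving_toLp ι
  have h0 : M.det ≠ 0 := by intro h; simp [h] at hM
  have h2 : MeasurePreserving (Matrix.toLin' M) (volume : Measure (ι → ℝ)) volume := by
    refine ⟨(Matrix.toLin' M).continuous_of_finiteDimensional.measurable, ?_⟩
    rw [Real.map_matrix_volume_pi_eq_smul_volume_pi h0, abs_inv, hM]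
    simp
  exact h3.comp (h2.comp h1)

/-- The change of variables `F ↦ F(M ·)` for a matrix `M` of determinant `±1` with inverse `N`. -/
def compAct [DecidableEq ι] (M N : Matrix ι ι ℝ) (hM : |M.det| = 1) (hN : |N.det| = 1)
    (h : M * N = 1) : L2 ι ≃ₗᵢ[ℂ] L2 ι where
  toLinearEquiv := LinearEquiv.ofLinearMap
    (Lp.compMeasurePreservingₗᵢ ℂ (act M) (measurePreserving_act M hM)).toLinearMap
    (Lp.compMeasurePreservingₗᵢ ℂ (act N) (measurePreserving_act N hN)).toLinearMap
    (by
      ext1 F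
      apply Lp.ext
      have h1 := Lp.coeFn_compMeasurePreserving
        (Lp.compMeasurePreserving (act N) (measurePreserving_act N hN) F)
        (measurePreserving_act M hM)
      have h2 := (measurePreserving_act M hM).quasiMeasurePreserving.ae_eq_comp
        (Lp.coeFn_compMeasurePreserving F (measurePreserving_act N hN))
      refine h1.trans (h2.trans (Filter.Eventually.of_forall fun t => ?_))
      simp [act_act, mul_eq_one_comm.1 h, act_one])
    (by
      ext1 F
      apply Lp.ext
      have h1 := Lp.coeFn_compMeasurePreserving
        (Lp.compMeasurePreserving (act M) (measurePreserving_act M hM) F)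
        (measurePreserving_act N hN)
      have h2 := (measurePreserving_act N hN).quasiMeasurePreserving.ae_eq_comp
        (Lp.coeFn_compMeasurePreserving F (measurePreserving_act M hM))
      refine h1.trans (h2.trans (Filter.Eventually.of_forall fun t => ?_))
      simp [act_act, h, act_one])
  norm_map' F := (Lp.compMeasurePreservingₗᵢ ℂ (act M) (measurePreserving_act M hM)).norm_map F

theorem coeFn_compAct [DecidableEq ι] {M N : Matrix ι ι ℝ} (hM : |M.det| = 1) (hN : |N.det| = 1)
    (h : M * N = 1) (F : L2 ι) :
    compAct M N hM hN h F =ᵐ[volume] fun t => F (act M t) :=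
  Lp.coeFn_compMeasurePreserving F (measurePreserving_act M hM)

/-- `Mt - x = M(t - Nx)` and `ξ·Mt = Mᵀξ·t`, while `Nx·Mᵀξ = x·ξ` leaves the scalar factor
unchanged. -/
theorem isMetaplectic_compAct [DecidableEq ι] {M N : Matrix ι ι ℝ} (hM : |M.det| = 1)
    (hN : |N.det| = 1) (h : M * N = 1) :
    IsMetaplectic (fromBlocks N 0 0 Mᵀ) (compAct M N hM hN h) := by
  intro z F
  have h0 := (measurePreserving_sub_right (volume : Measure (Vec ι))
    (act N (fstPart z))).quasiMeasurePreserving.ae_eq_comp (coeFn_compAct hM hN h F)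
  have h5 := (measurePreserving_act M hM).quasiMeasurePreserving.ae_eq_comp
    (coeFn_schrodinger z F)
  apply Lp.ext
  filter_upwards [coeFn_compAct hM hN h (schrodinger z F), h5,
    coeFn_schrodinger (act (fromBlocks N 0 0 Mᵀ) z) (compAct M N hM hN h F), h0] with t h1 h2 h3 h4
  simp only [Function.comp_apply] at h2 h4
  rw [h1, h2, h3]
  simp only [shiftFun, fstPart_act_fromBlocks, sndPart_act_fromBlocks, act_zero_matrix,
    add_zero, zero_add, h4, act_sub, act_act, h, act_one]
  rw [inner_act_left, inner_act_left, act_act, ← transpose_mul, h, transpose_one, act_one,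
    transpose_transpose]

/-! ### Schwartz functions -/

/-- The `n`-th derivative is `iⁿ e^{iθ}`, of modulus one. Chirps and characters inherit temperate
growth by composition with real polynomials. -/
theorem hasTemperateGrowth_exp_mul_I :
    Function.HasTemperateGrowth (fun θ : ℝ => Complex.exp (θ * Complex.I)) := by
  have hd : ∀ θ : ℝ, HasDerivAt (fun θ : ℝ => Complex.exp (θ * Complex.I))
      (Complex.I * Complex.exp (θ * Complex.I)) θ := fun θ => by
    have := ((Complex.ofRealCLM.hasDerivAt (x := θ)).mul_const Complex.I).cexp
    simpa [mul_comm] using this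
  have hn : ∀ n : ℕ, iteratedDeriv n (fun θ : ℝ => Complex.exp (θ * Complex.I)) =
      fun θ : ℝ => Complex.I ^ n * Complex.exp (θ * Complex.I) := by
    intro n
    induction n with
    | zero => simp
    | succ n ih =>
      rw [iteratedDeriv_succ, ih]
      ext θ
      rw [((hd θ).const_mul (Complex.I ^ n)).deriv, pow_succ, mul_assoc]
  refine ⟨Complex.contDiff_exp.comp (Complex.ofRealCLM.contDiff.mul contDiff_const), fun n => ⟨0, 1, fun θ => ?_⟩⟩
  rw [norm_iteratedFDeriv_eq_norm_iteratedDeriv, hn]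
  simp [Complex.norm_exp]

theorem hasTemperateGrowth_inner_clm {E : Type*} [NormedAddCommGroup E] [InnerProductSpace ℝ E]
    (L : E →L[ℝ] E) : Function.HasTemperateGrowth (fun x : E => inner ℝ x (L x)) := by
  have h1 : Function.HasTemperateGrowth (fun x : E => x) := .id'
  have h2 : Function.HasTemperateGrowth (fun x : E => L x) := L.hasTemperateGrowth
  -- Polarization reduces the bilinear expression to squared norms.
  have h3 : (fun x : E => inner ℝ x (L x)) =
      fun x => 4⁻¹ * (‖x + L x‖ ^ 2 - ‖x - L x‖ ^ 2) := by
    ext x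
    rw [norm_add_sq_real, norm_sub_sq_real]
    ring
  rw [h3]
  have ha : Function.HasTemperateGrowth (fun x : E => ‖x + L x‖ ^ 2) :=
    (Function.hasTemperateGrowth_norm_sq E).comp (h1.add h2)
  have hb : Function.HasTemperateGrowth (fun x : E => ‖x - L x‖ ^ 2) :=
    (Function.hasTemperateGrowth_norm_sq E).comp (h1.sub h2)
  exact (Function.HasTemperateGrowth.const _).mul (ha.sub hb)

theorem hasTemperateGrowth_phase (B : Matrix ι ι ℝ) : (phase B).HasTemperateGrowth := by
  have h := (hasTemperateGrowth_exp_mul_I).comp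
    ((Function.HasTemperateGrowth.const (-Real.pi)).mul (hasTemperateGrowth_inner_clm (actCLM B)))
  convert! h using 1
  ext ζ
  simp only [phase, Function.comp_apply, actCLM_apply, Pi.mul_apply]
  congr 1
  push_cast
  ring

/-- The character `t ↦ e^{2πi v·t}`. -/
def char (v t : Vec ι) : ℂ := Complex.exp (2 * Real.pi * Complex.I * (inner ℝ v t : ℝ))

theorem hasTemperateGrowth_char (v : Vec ι) : (char v).HasTemperateGrowth := by
  have h := (hasTemperateGrowth_exp_mul_I).comp
    ((Function.HasTemperateGrowth.const (2 * Real.pi)).mul (Function.hasTemperateGrowth_inner_right v))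
  convert! h using 1
  ext ζ
  simp only [char, Function.comp_apply, Pi.mul_apply]
  congr 1
  push_cast
  ring

theorem norm_char (v t : Vec ι) : ‖char v t‖ = 1 := by
  simp [char, Complex.norm_exp]

theorem continuous_char (v : Vec ι) : Continuous (char v) := by
  unfold char; fun_prop

theorem char_comm (v t : Vec ι) : char v t = char t v := by
  rw [char, char, real_inner_comm]

theorem char_sub (v t s : Vec ι) : char v (t - s) = char v t * char (-v) s := by
  rw [char, char, char, ← Complex.exp_add, inner_sub_right, inner_neg_left]
  push_cast
  ring_nf

theorem fourier_eq_char (f : Vec ι → ℂ) (w : Vec ι) :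
    𝓕 f w = ∫ v, char (-w) v * f v := by
  rw [Real.fourier_eq']
  refine integral_congr_ae (Filter.Eventually.of_forall fun v => ?_)
  simp only [char, smul_eq_mul, inner_neg_left, real_inner_comm w v]
  congr 2
  push_cast
  ring

theorem fourierInv_eq_char (f : Vec ι → ℂ) (w : Vec ι) :
    𝓕⁻ f w = ∫ v, char w v * f v := by
  rw [Real.fourierInv_eq']
  refine integral_congr_ae (Filter.Eventually.of_forall fun v => ?_)
  simp only [char, smul_eq_mul, real_inner_comm w v]
  congr 2
  push_cast
  ring

theorem shiftFun_eq_char (z : Vec (ι ⊕ ι)) (F : Vec ι → ℂ) (t : Vec ι) :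
    shiftFun z F t = Complex.exp (-(Real.pi * Complex.I * (inner ℝ (fstPart z) (sndPart z) : ℝ))) *
      char (sndPart z) t * F (t - fstPart z) := rfl

/-- The Schrödinger representation on Schwartz functions. -/
def shiftSchwartz (z : Vec (ι ⊕ ι)) (f : 𝓢(Vec ι, ℂ)) : 𝓢(Vec ι, ℂ) :=
  Complex.exp (-(Real.pi * Complex.I * (inner ℝ (fstPart z) (sndPart z) : ℝ))) •
    smulLeftCLM ℂ (char (sndPart z)) (compSubConstCLM ℂ (fstPart z) f)

theorem shiftSchwartz_apply (z : Vec (ι ⊕ ι)) (f : 𝓢(Vec ι, ℂ)) (t : Vec ι) :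
    shiftSchwartz z f t = shiftFun z f t := by
  simp [shiftSchwartz, shiftFun_eq_char, smulLeftCLM_apply_apply (hasTemperateGrowth_char _),
    mul_assoc]

theorem schrodinger_toLp (z : Vec (ι ⊕ ι)) (f : 𝓢(Vec ι, ℂ)) :
    schrodinger z (f.toLp 2 volume) = (shiftSchwartz z f).toLp 2 volume := by
  apply Lp.ext
  filter_upwards [coeFn_schrodinger z (f.toLp 2 volume), shiftFun_congr_ae z (f.coeFn_toLp 2 volume),
    (shiftSchwartz z f).coeFn_toLp 2 volume] with t h1 h2 h3
  rw [h1, h2, h3, shiftSchwartz_apply]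

theorem phaseMul_toLp (B : Matrix ι ι ℝ) (f : 𝓢(Vec ι, ℂ)) :
    phaseMul B (f.toLp 2 volume) = (smulLeftCLM ℂ (phase B) f).toLp 2 volume := by
  apply Lp.ext
  filter_upwards [coeFn_phaseMul B (f.toLp 2 volume), f.coeFn_toLp 2 volume,
    (smulLeftCLM ℂ (phase B) f).coeFn_toLp 2 volume] with t h1 h2 h3
  rw [h1, h2, h3, smulLeftCLM_apply_apply (hasTemperateGrowth_phase B), smul_eq_mul]

theorem fourierTransform_toLp (f : 𝓢(Vec ι, ℂ)) :
    Lp.fourierTransformₗᵢ (Vec ι) ℂ (f.toLp 2 volume) = (𝓕 f).toLp 2 volume :=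
  f.toLp_fourier_eq

theorem fourierTransform_symm_toLp (f : 𝓢(Vec ι, ℂ)) :
    (Lp.fourierTransformₗᵢ (Vec ι) ℂ).symm (f.toLp 2 volume) = (𝓕⁻ f).toLp 2 volume :=
  f.toLp_fourierInv_eq

/-! ### The Fourier transform is metaplectic -/

theorem fourier_shiftSchwartz [DecidableEq ι] (z : Vec (ι ⊕ ι)) (f : 𝓢(Vec ι, ℂ)) :
    𝓕 (shiftSchwartz z f) = shiftSchwartz (act (fromBlocks 0 1 (-1) 0) z) (𝓕 f) := by
  ext w
  rw [shiftSchwartz_apply, fourier_coe, fourier_eq_char, shiftFun_eq_char, fourier_coe,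
    fourier_eq_char, fstPart_act_fromBlocks, sndPart_act_fromBlocks,
    ← integral_sub_right_eq_self _ (-fstPart z), ← integral_const_mul]
  refine integral_congr_ae (Filter.Eventually.of_forall fun t => ?_)
  simp only [shiftSchwartz_apply, shiftFun_eq_char, act_neg_matrix, act_one, act_zero_matrix,
    zero_add, add_zero, sub_neg_eq_add, add_sub_cancel_right, char, ← Complex.exp_add, ← mul_assoc]
  congr 2
  simp only [inner_sub_left, inner_add_right, inner_neg_left, inner_neg_right,
    real_inner_comm (fstPart z) (sndPart z), real_inner_comm (fstPart z) w]
  push_cast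
  ring

theorem isMetaplectic_fourier [DecidableEq ι] :
    IsMetaplectic (fromBlocks 0 1 (-1) 0 : Matrix (ι ⊕ ι) (ι ⊕ ι) ℝ)
      (Lp.fourierTransformₗᵢ (Vec ι) ℂ) := by
  intro z F
  -- Both sides are continuous in `F`, so the dense subspace of Schwartz functions suffices.
  refine DenseRange.induction_on (p := fun F : L2 ι => Lp.fourierTransformₗᵢ (Vec ι) ℂ
    (schrodinger z F) = schrodinger (act (fromBlocks 0 1 (-1) 0) z)
      (Lp.fourierTransformₗᵢ (Vec ι) ℂ F))
    (SchwartzMap.denseRange_toLpCLM (p := 2) ENNReal.ofNat_ne_top) F ?_ ?_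
  · exact isClosed_eq
      ((LinearIsometryEquiv.continuous _).comp (continuous_schrodinger z))
      ((continuous_schrodinger _).comp (LinearIsometryEquiv.continuous _))
  · intro f
    rw [toLpCLM_apply, schrodinger_toLp, fourierTransform_toLp, fourierTransform_toLp,
      schrodinger_toLp, fourier_shiftSchwartz]

/-! ### Convolution with the inverse Fourier transform of a chirp -/

theorem fourierInv_reflectTranslate (w : 𝓢(Vec ι, ℂ)) (z ζ : Vec ι) :
    𝓕⁻ (reflectTranslate w z) ζ = char z ζ * 𝓕 w ζ := by
  rw [fourierInv_coe, fourierInv_eq_char, fourier_coe, fourier_eq_char,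
    ← integral_sub_left_eq_self _ volume z, ← integral_const_mul]
  refine integral_congr_ae (Filter.Eventually.of_forall fun t => ?_)
  simp only [reflectTranslate_apply, sub_sub_cancel]
  rw [char_sub, char_comm ζ z, mul_assoc]

/-- The convolution theorem: by duality `𝓕⁻` passes to the test function `w(z - ·)`, where it gives
`𝓕 w` times a character, and the pairing becomes an inverse Fourier integral. -/
theorem conv_fourierInv_phaseDistribution (B : Matrix ι ι ℝ) (w : 𝓢(Vec ι, ℂ)) (z : Vec ι) :
    conv w (𝓕⁻ (phaseDistribution B)) z = 𝓕⁻ (smulLeftCLM ℂ (phase B) (𝓕 w)) z := by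
  rw [conv, TemperedDistribution.fourierInv_apply, phaseDistribution_apply,
    fourierInv_coe (smulLeftCLM ℂ (phase B) (𝓕 w)), fourierInv_eq_char]
  refine integral_congr_ae (Filter.Eventually.of_forall fun ζ => ?_)
  simp only [fourierInv_reflectTranslate, smulLeftCLM_apply_apply (hasTemperateGrowth_phase B),
    smul_eq_mul]
  ring

/-! ### The partial Fourier transform -/

/-- The vector `(x, ξ)`. -/
def joinParts {ι : Type*} (x ξ : Vec ι) : Vec (ι ⊕ ι) := WithLp.toLp 2 (Sum.elim x.ofLp ξ.ofLp)

@[simp] theorem fstPart_joinParts {ι : Type*} (x ξ : Vec ι) : fstPart (joinParts x ξ) = x := rfl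

@[simp] theorem sndPart_joinParts {ι : Type*} (x ξ : Vec ι) : sndPart (joinParts x ξ) = ξ := rfl

theorem ext_parts {ι : Type*} {z w : Vec (ι ⊕ ι)} (h1 : fstPart z = fstPart w)
    (h2 : sndPart z = sndPart w) : z = w := by
  ext (i | i)
  · exact congrArg (fun v : Vec ι => v i) h1
  · exact congrArg (fun v : Vec ι => v i) h2

theorem fstPart_sub {ι : Type*} (z w : Vec (ι ⊕ ι)) : fstPart (z - w) = fstPart z - fstPart w := rfl

theorem sndPart_sub {ι : Type*} (z w : Vec (ι ⊕ ι)) : sndPart (z - w) = sndPart z - sndPart w := rfl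

theorem norm_sq_eq_parts (z : Vec (ι ⊕ ι)) : ‖z‖ ^ 2 = ‖fstPart z‖ ^ 2 + ‖sndPart z‖ ^ 2 := by
  rw [← real_inner_self_eq_norm_sq, ← real_inner_self_eq_norm_sq, ← real_inner_self_eq_norm_sq,
    inner_eq_inner_parts]

theorem sndPart_neg {ι : Type*} (z : Vec (ι ⊕ ι)) : sndPart (-z) = -sndPart z := rfl

/-- The projection `(x, ξ) ↦ x`. -/
def fstCLM : Vec (ι ⊕ ι) →L[ℝ] Vec ι :=
  LinearMap.toContinuousLinearMap
    { toFun := fstPart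
      map_add' := fun _ _ => rfl
      map_smul' := fun _ _ => rfl }

/-- The projection `(x, ξ) ↦ ξ`. -/
def sndCLM : Vec (ι ⊕ ι) →L[ℝ] Vec ι :=
  LinearMap.toContinuousLinearMap
    { toFun := sndPart
      map_add' := fun _ _ => rfl
      map_smul' := fun _ _ => rfl }

theorem fstCLM_apply (z : Vec (ι ⊕ ι)) : fstCLM z = fstPart z := rfl

theorem sndCLM_apply (z : Vec (ι ⊕ ι)) : sndCLM z = sndPart z := rfl

theorem continuous_sndPart : Continuous (sndPart : Vec (ι ⊕ ι) → Vec ι) := sndCLM.continuous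

/-- The inclusion `ξ ↦ (0, ξ)`. -/
def inrCLM : Vec ι →L[ℝ] Vec (ι ⊕ ι) :=
  LinearMap.toContinuousLinearMap
    { toFun := joinParts 0
      map_add' := fun _ _ => ext_parts (add_zero _).symm rfl
      map_smul' := fun c _ => ext_parts (smul_zero c).symm rfl }

theorem inrCLM_apply (s : Vec ι) : inrCLM s = joinParts 0 s := rfl

theorem norm_inrCLM (s : Vec ι) : ‖inrCLM s‖ = ‖s‖ := by
  rw [← sq_eq_sq₀ (norm_nonneg _) (norm_nonneg _), norm_sq_eq_parts, inrCLM_apply]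
  simp

theorem inner_inrCLM (s : Vec ι) (ζ : Vec (ι ⊕ ι)) :
    inner ℝ (inrCLM s) ζ = inner ℝ s (sndPart ζ) := by
  rw [inner_eq_inner_parts, inrCLM_apply]
  simp

theorem char_inrCLM (s : Vec ι) (ζ : Vec (ι ⊕ ι)) :
    char (inrCLM s) ζ = char (sndPart ζ) s := by
  rw [char_comm (sndPart ζ), char, char, inner_inrCLM]

/-- The restriction of a Schwartz function to an affine fibre `s ↦ z - (0, s)`. -/
def fibre (Ψ : 𝓢(Vec (ι ⊕ ι), ℂ)) (z : Vec (ι ⊕ ι)) : 𝓢(Vec ι, ℂ) :=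
  compCLMOfAntilipschitz ℝ (K := 1) (g := fun s => z - inrCLM s)
    ((Function.HasTemperateGrowth.const z).sub inrCLM.hasTemperateGrowth)
    (AntilipschitzWith.of_le_mul_dist fun s t => by
      simp only [dist_sub_left, NNReal.coe_one, one_mul]
      rw [dist_eq_norm, dist_eq_norm, ← map_sub, norm_inrCLM]) Ψ

theorem fibre_apply (Ψ : 𝓢(Vec (ι ⊕ ι), ℂ)) (z : Vec (ι ⊕ ι)) (s : Vec ι) :
    fibre Ψ z s = Ψ (z - inrCLM s) := rfl

/-! ### Gaussian and chirp Fourier multipliers -/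

theorem fourierInv_fourier_apply (Ψ : 𝓢(Vec ι, ℂ)) (z : Vec ι) :
    ∫ ζ, char z ζ * 𝓕 Ψ ζ = Ψ z := by
  rw [← fourierInv_eq_char, ← fourierInv_coe, fourierInv_fourier_eq]

theorem integrable_gaussian {b : ℂ} (hb : 0 < b.re) :
    Integrable (fun s : Vec ι => Complex.exp (-(Real.pi * b) * ‖s‖ ^ 2)) := by
  have hb' : 0 < ((Real.pi : ℂ) * b).re := by
    rw [Complex.re_ofReal_mul]; exact mul_pos Real.pi_pos hb
  simpa using GaussianFourier.integrable_cexp_neg_mul_sq_norm_add hb' 0 (0 : Vec ι)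

theorem inv_re_pos {b : ℂ} (hb : 0 < b.re) : 0 < b⁻¹.re := by
  rw [Complex.inv_re]
  exact div_pos hb (Complex.normSq_pos.2 (by rintro rfl; simp at hb))

/-- Parametrized so that `b → i` gives the multiplier `e^{-πi|τ|²}` on the right and the kernel
`e^{πi|s|²}` on the left. -/
theorem fourier_gaussian {b : ℂ} (hb : 0 < b.re) (τ : Vec ι) :
    ∫ s : Vec ι, char (-τ) s * Complex.exp (-(Real.pi * b⁻¹) * ‖s‖ ^ 2) =
      b ^ (Fintype.card ι / 2 : ℂ) * Complex.exp (-(Real.pi * b) * ‖τ‖ ^ 2) := by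
  have hb0 : b ≠ 0 := by rintro rfl; simp at hb
  have hpi : (Real.pi : ℂ) ≠ 0 := by exact_mod_cast Real.pi_ne_zero
  have hb' : 0 < ((Real.pi : ℂ) * b⁻¹).re := by
    rw [Complex.re_ofReal_mul]; exact mul_pos Real.pi_pos (inv_re_pos hb)
  rw [← fourier_eq_char, fourier_gaussian_innerProductSpace hb' τ]
  congr 2
  · field_simp
  · simp
  · field_simp

/-- A Gaussian Fourier multiplier in the second variable is a convolution with a Gaussian. -/
theorem fourierInv_gaussian_mul_fourier {b : ℂ} (hb : 0 < b.re) (Ψ : 𝓢(Vec (ι ⊕ ι), ℂ))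
    (z : Vec (ι ⊕ ι)) :
    b ^ (Fintype.card ι / 2 : ℂ) *
        ∫ ζ, char z ζ * (Complex.exp (-(Real.pi * b) * ‖sndPart ζ‖ ^ 2) * 𝓕 Ψ ζ) =
      ∫ s : Vec ι, Complex.exp (-(Real.pi * b⁻¹) * ‖s‖ ^ 2) * Ψ (z - inrCLM s) := by
  set k : Vec ι → ℂ := fun s => Complex.exp (-(Real.pi * b⁻¹) * ‖s‖ ^ 2) with hk
  have hki : Integrable k := integrable_gaussian (inv_re_pos hb)
  -- Fubini needs the Gaussian to be integrable, hence `Re b > 0`; the chirp `b = i` is only reached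
  -- as a limit.
  have hint : Integrable (Function.uncurry fun (ζ : Vec (ι ⊕ ι)) (s : Vec ι) =>
      char z ζ * char (-sndPart ζ) s * (𝓕 Ψ ζ * k s)) (volume.prod volume) := by
    refine ((𝓕 Ψ).integrable (μ := volume) |>.mul_prod hki).bdd_mul (c := 1) ?_ ?_
    · refine Continuous.aestronglyMeasurable ?_
      have := continuous_sndPart (ι := ι)
      unfold char
      fun_prop
    · exact Filter.Eventually.of_forall fun p => by simp [norm_char]
  calc _ = ∫ ζ, ∫ s, char z ζ * char (-sndPart ζ) s * (𝓕 Ψ ζ * k s) := by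
        rw [← integral_const_mul]
        refine integral_congr_ae (Filter.Eventually.of_forall fun ζ => ?_)
        have h := fourier_gaussian hb (sndPart ζ)
        calc _ = char z ζ * 𝓕 Ψ ζ * (b ^ (Fintype.card ι / 2 : ℂ) *
              Complex.exp (-(Real.pi * b) * ‖sndPart ζ‖ ^ 2)) := by ring
          _ = _ := by
            rw [← h, ← integral_const_mul]
            refine integral_congr_ae (Filter.Eventually.of_forall fun s => ?_)
            simp only [hk]
            ring
    _ = ∫ s, ∫ ζ, char z ζ * char (-sndPart ζ) s * (𝓕 Ψ ζ * k s) := integral_integral_swap hint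
    _ = _ := by
        refine integral_congr_ae (Filter.Eventually.of_forall fun s => ?_)
        simp only
        rw [← fourierInv_fourier_apply Ψ, ← integral_const_mul]
        refine integral_congr_ae (Filter.Eventually.of_forall fun ζ => ?_)
        simp only
        rw [char_comm (z - inrCLM s), char_sub, char_comm ζ z, char_comm (-ζ), char_inrCLM,
          sndPart_neg]
        ring

/-- The matrix of the quadratic form `(x, ξ) ↦ ξ·ξ`. -/
def sndForm (ι : Type*) [DecidableEq ι] : Matrix (ι ⊕ ι) (ι ⊕ ι) ℝ := fromBlocks 0 0 0 1

theorem phase_sndForm [DecidableEq ι] (ζ : Vec (ι ⊕ ι)) :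
    phase (sndForm ι) ζ = Complex.exp (-(Real.pi * Complex.I) * ‖sndPart ζ‖ ^ 2) := by
  rw [phase, sndForm, inner_eq_inner_parts, fstPart_act_fromBlocks, sndPart_act_fromBlocks]
  simp [act_zero_matrix, act_one]

theorem norm_exp_le_one_of_re {a : ℂ} (ha : 0 ≤ a.re) (r : ℝ) :
    ‖Complex.exp (-(Real.pi * a) * r ^ 2)‖ ≤ 1 := by
  rw [Complex.norm_exp, Real.exp_le_one_iff]
  have : (-(Real.pi * a) * (r : ℂ) ^ 2).re = -(Real.pi * a.re * r ^ 2) := by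
    rw [← Complex.ofReal_pow, Complex.re_mul_ofReal, Complex.neg_re, Complex.re_ofReal_mul]
    ring
  rw [this]
  have := Real.pi_pos
  have : 0 ≤ Real.pi * a.re * r ^ 2 := by positivity
  linarith

/-- The chirp Fourier multiplier in the second variable is a convolution with a chirp. -/
theorem fourierInv_phase_mul_fourier [DecidableEq ι] (Ψ : 𝓢(Vec (ι ⊕ ι), ℂ)) (z : Vec (ι ⊕ ι)) :
    Complex.I ^ (Fintype.card ι / 2 : ℂ) *
        𝓕⁻ (smulLeftCLM ℂ (phase (sndForm ι)) (𝓕 Ψ)) z =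
      ∫ s : Vec ι, Complex.exp (Real.pi * Complex.I * ‖s‖ ^ 2) * Ψ (z - inrCLM s) := by
  -- Put `b = ε + i` and let `ε → 0⁺` on both sides of the Gaussian identity.
  have hb : Filter.Tendsto (fun ε : ℝ => (ε : ℂ) + Complex.I) (nhdsWithin 0 (Set.Ioi 0))
      (nhds Complex.I) := by
    have : Continuous fun ε : ℝ => (ε : ℂ) + Complex.I := by fun_prop
    simpa using (this.tendsto 0).mono_left nhdsWithin_le_nhds
  have hpos : ∀ᶠ ε : ℝ in nhdsWithin 0 (Set.Ioi 0), 0 < ((ε : ℂ) + Complex.I).re := by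
    filter_upwards [self_mem_nhdsWithin] with ε hε
    simpa using hε
  have hL : Filter.Tendsto (fun ε : ℝ => ((ε : ℂ) + Complex.I) ^ (Fintype.card ι / 2 : ℂ) *
        ∫ ζ, char z ζ * (Complex.exp (-(Real.pi * ((ε : ℂ) + Complex.I)) * ‖sndPart ζ‖ ^ 2) *
          𝓕 Ψ ζ)) (nhdsWithin 0 (Set.Ioi 0))
      (nhds (Complex.I ^ (Fintype.card ι / 2 : ℂ) *
        ∫ ζ, char z ζ * (Complex.exp (-(Real.pi * Complex.I) * ‖sndPart ζ‖ ^ 2) * 𝓕 Ψ ζ))) := by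
    refine Filter.Tendsto.mul ?_ ?_
    -- `i` lies off the branch cut, so the principal power is continuous there.
    · exact hb.cpow tendsto_const_nhds (by simp [Complex.slitPlane])
    · refine tendsto_integral_filter_of_dominated_convergence (fun ζ => ‖𝓕 Ψ ζ‖) ?_ ?_
        (𝓕 Ψ).integrable.norm ?_
      · refine Filter.Eventually.of_forall fun ε => Continuous.aestronglyMeasurable ?_
        have := continuous_sndPart (ι := ι)
        have := continuous_char z
        have := (𝓕 Ψ).continuous
        fun_prop
      · filter_upwards [hpos] with ε hε
        refine Filter.Eventually.of_forall fun ζ => ?_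
        rw [norm_mul, norm_mul, norm_char, one_mul]
        exact mul_le_of_le_one_left (norm_nonneg _) (norm_exp_le_one_of_re hε.le _)
      · refine Filter.Eventually.of_forall fun ζ => ?_
        refine Filter.Tendsto.const_mul _ (Filter.Tendsto.mul_const _ ?_)
        exact (Complex.continuous_exp.tendsto _).comp
          (((hb.const_mul _).neg).mul_const _)
  have hR : Filter.Tendsto (fun ε : ℝ => ∫ s : Vec ι,
        Complex.exp (-(Real.pi * ((ε : ℂ) + Complex.I)⁻¹) * ‖s‖ ^ 2) * Ψ (z - inrCLM s))
      (nhdsWithin 0 (Set.Ioi 0))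
      (nhds (∫ s : Vec ι, Complex.exp (-(Real.pi * Complex.I⁻¹) * ‖s‖ ^ 2) *
        Ψ (z - inrCLM s))) := by
    -- The Gaussians are bounded by one, so the restriction of `Ψ` to the fibre, itself Schwartz,
    -- dominates.
    refine tendsto_integral_filter_of_dominated_convergence (fun s => ‖fibre Ψ z s‖) ?_ ?_
      (fibre Ψ z).integrable.norm ?_
    · refine Filter.Eventually.of_forall fun ε => Continuous.aestronglyMeasurable ?_
      have := Ψ.continuous
      fun_prop
    · filter_upwards [hpos] with ε hε
      refine Filter.Eventually.of_forall fun s => ?_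
      rw [norm_mul, fibre_apply]
      exact mul_le_of_le_one_left (norm_nonneg _) (norm_exp_le_one_of_re (inv_re_pos hε).le _)
    · refine Filter.Eventually.of_forall fun s => ?_
      refine Filter.Tendsto.mul_const _ ?_
      exact (Complex.continuous_exp.tendsto _).comp
        ((((hb.inv₀ Complex.I_ne_zero).const_mul _).neg).mul_const _)
  have heq := tendsto_nhds_unique (hL.congr' (by
    filter_upwards [hpos] with ε hε
    exact fourierInv_gaussian_mul_fourier hε Ψ z)) hR
  rw [fourierInv_coe, fourierInv_eq_char]
  simp only [smulLeftCLM_apply_apply (hasTemperateGrowth_phase _), smul_eq_mul, phase_sndForm]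
  rw [heq]
  simp

/-- The partial Fourier transform in the second variable, up to the factor `i^{-d/2}`, as a product
of chirps and full Fourier transforms. -/
def partialFourier [DecidableEq ι] (Φ : 𝓢(Vec (ι ⊕ ι), ℂ)) : 𝓢(Vec (ι ⊕ ι), ℂ) :=
  Complex.I ^ (Fintype.card ι / 2 : ℂ) • smulLeftCLM ℂ (phase (sndForm ι))
    (𝓕⁻ (smulLeftCLM ℂ (phase (sndForm ι)) (𝓕 (smulLeftCLM ℂ (phase (sndForm ι)) Φ))))

theorem partialFourier_apply [DecidableEq ι] (Φ : 𝓢(Vec (ι ⊕ ι), ℂ)) (z : Vec (ι ⊕ ι)) :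
    partialFourier Φ z = ∫ t, Φ (joinParts (fstPart z) t) * char (-sndPart z) t := by
  have hz : ∀ s : Vec ι, z - inrCLM (sndPart z - s) = joinParts (fstPart z) s := fun s =>
    ext_parts (by simp [fstPart_sub, inrCLM_apply]) (by simp [sndPart_sub, inrCLM_apply])
  rw [partialFourier, _root_.smul_apply,
    smulLeftCLM_apply_apply (hasTemperateGrowth_phase _), smul_comm, smul_eq_mul (Complex.I ^ _),
    fourierInv_phase_mul_fourier, ← integral_sub_left_eq_self _ volume (sndPart z), smul_eq_mul,
    ← integral_const_mul]
  refine integral_congr_ae (Filter.Eventually.of_forall fun t => ?_)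
  simp only [hz, smulLeftCLM_apply_apply (hasTemperateGrowth_phase _), smul_eq_mul, phase_sndForm,
    sndPart_joinParts]
  -- The three chirps combine into the Fourier character, since `-|ξ|² + |ξ - t|² - |t|² = -2ξ·t`.
  calc _ = Φ (joinParts (fstPart z) t) *
      (Complex.exp (-(Real.pi * Complex.I) * ‖sndPart z‖ ^ 2) *
        Complex.exp (Real.pi * Complex.I * ‖sndPart z - t‖ ^ 2) *
        Complex.exp (-(Real.pi * Complex.I) * ‖t‖ ^ 2)) := by ring
    _ = _ := by
      rw [char, ← Complex.exp_add, ← Complex.exp_add]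
      congr 2
      simp only [← Complex.ofReal_pow, norm_sub_sq_real, inner_neg_left]
      push_cast
      ring

/-! ### Irreducibility of the Schrödinger representation -/

theorem memLp_schwartz_mul (h : 𝓢(Vec ι, ℂ)) {F : Vec ι → ℂ} (hF : MemLp F 2 volume) :
    MemLp (fun t => h t * F t) 2 volume := by
  obtain ⟨C, -, hC⟩ := h.decay 0 0
  refine hF.of_le_mul (c := C) (h.continuous.aestronglyMeasurable.mul hF.1)
    (Filter.Eventually.of_forall fun t => ?_)
  rw [norm_mul]
  have := hC t
  simp only [pow_zero, one_mul, norm_iteratedFDeriv_zero] at this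
  gcongr

/-- Multiplication of an `L²` function by a Schwartz function. -/
def schwartzMul (h : 𝓢(Vec ι, ℂ)) (F : L2 ι) : L2 ι := (memLp_schwartz_mul h (Lp.memLp F)).toLp _

theorem coeFn_schwartzMul (h : 𝓢(Vec ι, ℂ)) (F : L2 ι) :
    schwartzMul h F =ᵐ[volume] fun t => h t * F t :=
  MemLp.coeFn_toLp _

theorem shiftFun_modulation (ξ : Vec ι) (F : Vec ι → ℂ) (t : Vec ι) :
    shiftFun (joinParts 0 ξ) F t = char ξ t * F t := by
  simp [shiftFun_eq_char]

theorem shiftFun_translation (x : Vec ι) (F : Vec ι → ℂ) (t : Vec ι) :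
    shiftFun (joinParts x 0) F t = F (t - x) := by
  simp [shiftFun_eq_char, char]

/-- A Schwartz multiplier is a superposition of modulations. -/
theorem inner_schwartzMul (h : 𝓢(Vec ι, ℂ)) (F G : L2 ι) :
    inner ℂ G (schwartzMul h F) =
      ∫ ξ, 𝓕 h ξ * inner ℂ G (schrodinger (joinParts 0 ξ) F) := by
  have hFG : Integrable (fun t => F t * conj (G t)) := by
    simpa only [RCLike.inner_apply] using L2.integrable_inner (𝕜 := ℂ) G F
  have hint : Integrable (Function.uncurry fun (t ξ : Vec ι) =>
      char ξ t * ((F t * conj (G t)) * 𝓕 h ξ)) (volume.prod volume) := by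
    refine (hFG.mul_prod ((𝓕 h).integrable (μ := volume))).bdd_mul (c := 1) ?_ ?_
    · refine Continuous.aestronglyMeasurable ?_
      unfold char
      fun_prop
    · exact Filter.Eventually.of_forall fun p => by simp [norm_char]
  calc inner ℂ G (schwartzMul h F) = ∫ t, ∫ ξ, char ξ t * ((F t * conj (G t)) * 𝓕 h ξ) := by
        rw [L2.inner_def]
        refine integral_congr_ae ?_
        filter_upwards [coeFn_schwartzMul h F] with t ht
        rw [ht, RCLike.inner_apply,
          show h t * F t * conj (G t) = F t * conj (G t) * h t by ring,
          ← fourierInv_fourier_apply h t, ← integral_const_mul]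
        refine integral_congr_ae (Filter.Eventually.of_forall fun ξ => ?_)
        simp only [char_comm t ξ]
        ring
    _ = ∫ ξ, ∫ t, char ξ t * ((F t * conj (G t)) * 𝓕 h ξ) := integral_integral_swap hint
    _ = _ := by
        refine integral_congr_ae (Filter.Eventually.of_forall fun ξ => ?_)
        simp only
        rw [L2.inner_def, ← integral_const_mul]
        refine integral_congr_ae ?_
        filter_upwards [coeFn_schrodinger (joinParts 0 ξ) F] with t ht
        rw [ht, RCLike.inner_apply, shiftFun_modulation]
        ring

/-- Pairing with a vector `V G'` lets unitarity remove `V` from both sides. The scalar integrals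
over modulations then agree, with no vector-valued integral needed. -/
theorem map_schwartzMul {V : L2 ι ≃ₗᵢ[ℂ] L2 ι}
    (hV : ∀ z F, V (schrodinger z F) = schrodinger z (V F)) (h : 𝓢(Vec ι, ℂ)) (F : L2 ι) :
    V (schwartzMul h F) = schwartzMul h (V F) := by
  refine ext_inner_left ℂ fun G => ?_
  rw [← V.apply_symm_apply G, V.inner_map_map, inner_schwartzMul, inner_schwartzMul]
  simp only [← hV, V.inner_map_map]

variable (ι) in
/-- The polynomial weight `(1 + |t|²)^(d+1)`. -/
def weight (t : Vec ι) : ℂ := ((1 + ‖t‖ ^ 2 : ℝ) : ℂ) ^ (Fintype.card ι + 1)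

theorem weight_ne_zero (t : Vec ι) : weight ι t ≠ 0 := by
  refine pow_ne_zero _ ?_
  exact_mod_cast (by positivity : (1 + ‖t‖ ^ 2 : ℝ) ≠ 0)

theorem continuous_weight : Continuous (weight ι) := by
  unfold weight
  fun_prop

theorem hasTemperateGrowth_weight : (weight ι).HasTemperateGrowth := by
  have h : Function.HasTemperateGrowth (fun t : Vec ι => 1 + ‖t‖ ^ 2) :=
    (Function.HasTemperateGrowth.const (1 : ℝ)).add
      (Function.hasTemperateGrowth_norm_sq (Vec ι))
  exact (Function.Complex.hasTemperateGrowth_ofReal.comp h).pow _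

theorem memLp_inv_weight : MemLp (fun t => (weight ι t)⁻¹) 2 volume := by
  rw [memLp_two_iff_integrable_sq_norm
    (by exact (continuous_weight.inv₀ weight_ne_zero).aestronglyMeasurable)]
  -- The squared norm is `(1 + |t|²)^{-r/2}` with `r = 4(d + 1) > d`.
  have hr : (Module.finrank ℝ (Vec ι) : ℝ) < 4 * (Fintype.card ι + 1 : ℕ) := by
    rw [finrank_euclideanSpace]
    push_cast
    have : (0 : ℝ) ≤ Fintype.card ι := Nat.cast_nonneg _
    linarith
  refine (integrable_rpow_neg_one_add_norm_sq (μ := (volume : Measure (Vec ι))) hr).congr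
    (Filter.Eventually.of_forall fun t => ?_)
  have hp : (0 : ℝ) ≤ 1 + ‖t‖ ^ 2 := by positivity
  have he : -(4 * ((Fintype.card ι + 1 : ℕ) : ℝ)) / 2 = -((2 * (Fintype.card ι + 1) : ℕ) : ℝ) := by
    push_cast; ring
  simp only [weight, norm_inv, norm_pow, Complex.norm_real, Real.norm_of_nonneg hp]
  rw [he, Real.rpow_neg hp, Real.rpow_natCast, mul_comm, pow_mul, inv_pow]

/-- The null set in `t` depends on `x`. Fubini exchanges the quantifiers and yields one `t₀` with
`m(t₀ + x) = m(t₀)` for almost every `x`. -/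
theorem exists_ae_eq_const_of_forall_translate {m : Vec ι → ℂ} (hm : Measurable m)
    (h : ∀ x, ∀ᵐ t, m (t + x) = m t) : ∃ c, ∀ᵐ t, m t = c := by
  have hs : MeasurableSet {p : Vec ι × Vec ι | m (p.2 + p.1) = m p.2} :=
    measurableSet_eq_fun (by fun_prop) (by fun_prop)
  have h1 : ∀ᵐ x : Vec ι, ∀ᵐ t : Vec ι, m (t + x) = m t := Filter.Eventually.of_forall h
  have h2 : ∀ᵐ t : Vec ι, ∀ᵐ x : Vec ι, m (t + x) = m t := (Measure.ae_ae_comm hs).1 h1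
  obtain ⟨t₀, ht₀⟩ := h2.exists
  refine ⟨m t₀, ?_⟩
  have := (measurePreserving_sub_right (volume : Measure (Vec ι)) t₀).quasiMeasurePreserving.ae ht₀
  filter_upwards [this] with y hy
  simpa using hy

/-- Countably many bump functions, nonzero on balls exhausting the space, can be cancelled outside
one common null set. -/
theorem ae_eq_zero_of_forall_mul_schwartz {u : Vec ι → ℂ}
    (h : ∀ φ : 𝓢(Vec ι, ℂ), ∀ᵐ t, u t * φ t = 0) : ∀ᵐ t, u t = 0 := by
  have hb : ∀ n : ℕ, ∃ φ : 𝓢(Vec ι, ℂ), ∀ t, ‖t‖ ≤ n + 1 → φ t ≠ 0 := by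
    intro n
    let b : ContDiffBump (0 : Vec ι) := ⟨n + 1, n + 2, by positivity, by linarith⟩
    have hc : HasCompactSupport (fun t => (b t : ℂ)) :=
      b.hasCompactSupport.comp_left (g := fun r : ℝ => (r : ℂ)) Complex.ofReal_zero
    have hd : ContDiff ℝ ((⊤ : ℕ∞) : WithTop ℕ∞) (fun t => (b t : ℂ)) :=
      Complex.ofRealCLM.contDiff.comp b.contDiff
    refine ⟨hc.toSchwartzMap hd, fun t ht => ?_⟩
    have : b t = 1 := b.one_of_mem_closedBall (by simpa using ht)
    change (b t : ℂ) ≠ 0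
    simp [this]
  choose φ hφ using hb
  filter_upwards [ae_all_iff.2 fun n => h (φ n)] with t ht
  obtain ⟨n, hn⟩ := exists_nat_ge ‖t‖
  exact (mul_eq_zero.1 (ht n)).resolve_right (hφ n t (by linarith))

/-- Schur's lemma for the Schrödinger representation. -/
theorem exists_eq_smul_of_commute {V : L2 ι ≃ₗᵢ[ℂ] L2 ι}
    (hV : ∀ z F, V (schrodinger z F) = schrodinger z (V F)) :
    ∃ c : ℂ, ‖c‖ = 1 ∧ ∀ F, V F = c • F := by
  set F₀ : L2 ι := memLp_inv_weight.toLp _ with hF₀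
  have hF₀c : F₀ =ᵐ[volume] fun t => (weight ι t)⁻¹ := MemLp.coeFn_toLp _
  -- The symbol of a multiplication operator is read off from its value at the nowhere vanishing
  -- `L²` function `F₀ = 1/weight`.
  set m : Vec ι → ℂ := fun t => weight ι t * V F₀ t with hm
  have hmm : Measurable m :=
    continuous_weight.measurable.mul (Lp.stronglyMeasurable (V F₀)).measurable
  have hmul : ∀ φ : 𝓢(Vec ι, ℂ), V (φ.toLp 2 volume) =ᵐ[volume] fun t => m t * φ t := by
    intro φ
    -- `φ = (weight · φ) · F₀` with `weight · φ` Schwartz, so `V` passes through the first factor.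
    have h1 : φ.toLp 2 volume = schwartzMul (smulLeftCLM ℂ (weight ι) φ) F₀ := by
      apply Lp.ext
      filter_upwards [φ.coeFn_toLp 2 volume, coeFn_schwartzMul (smulLeftCLM ℂ (weight ι) φ) F₀,
        hF₀c] with t h1 h2 h3
      rw [h1, h2, h3, smulLeftCLM_apply_apply hasTemperateGrowth_weight, smul_eq_mul]
      field_simp [weight_ne_zero t]
    rw [h1, map_schwartzMul hV]
    filter_upwards [coeFn_schwartzMul (smulLeftCLM ℂ (weight ι) φ) (V F₀)] with t ht
    rw [ht, smulLeftCLM_apply_apply hasTemperateGrowth_weight, smul_eq_mul]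
    ring
  have htrans : ∀ x, ∀ᵐ t, m (t + x) = m t := by
    intro x
    suffices h : ∀ᵐ t, m (t + x) - m t = 0 by
      filter_upwards [h] with t ht using sub_eq_zero.1 ht
    refine ae_eq_zero_of_forall_mul_schwartz fun φ => ?_
    have h1 := hmul (shiftSchwartz (joinParts x 0) φ)
    rw [← schrodinger_toLp, hV] at h1
    have h2 := (coeFn_schrodinger (joinParts x 0) (V (φ.toLp 2 volume))).symm.trans h1
    have h3 := (shiftFun_congr_ae (joinParts x 0) (hmul φ)).symm.trans h2
    have h4 := (measurePreserving_add_right (volume : Measure (Vec ι))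
      x).quasiMeasurePreserving.ae_eq_comp h3
    filter_upwards [h4] with t ht
    simp only [Function.comp_apply, shiftSchwartz_apply, shiftFun_translation,
      add_sub_cancel_right] at ht
    rw [sub_mul, ht, sub_self]
  obtain ⟨c, hc⟩ := exists_ae_eq_const_of_forall_translate hmm htrans
  have hVc : ∀ F, V F = c • F := by
    intro F
    refine DenseRange.induction_on (p := fun F : L2 ι => V F = c • F)
      (SchwartzMap.denseRange_toLpCLM (p := 2) ENNReal.ofNat_ne_top) F ?_ ?_
    · exact isClosed_eq V.continuous (continuous_const_smul c)
    · intro φ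
      rw [toLpCLM_apply]
      apply Lp.ext
      filter_upwards [hmul φ, hc, Lp.coeFn_smul c (φ.toLp 2 volume), φ.coeFn_toLp 2 volume]
        with t h1 h2 h3 h4
      rw [h1, h2, h3, Pi.smul_apply, h4, smul_eq_mul]
  refine ⟨c, ?_, hVc⟩
  have h0 : F₀ ≠ 0 := by
    intro h
    obtain ⟨t, ht1, ht2⟩ := (hF₀c.and (Lp.eq_zero_iff_ae_eq_zero.1 h)).exists
    rw [ht1] at ht2
    exact inv_ne_zero (weight_ne_zero t) ht2
  have h1 := V.norm_map F₀
  rw [hVc, norm_smul] at h1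
  exact mul_right_cancel₀ (norm_ne_zero_iff.2 h0) (h1.trans (one_mul _).symm)

/-! ### Tensor products of Schwartz functions -/

theorem norm_fstCLM_le : ‖(fstCLM : Vec (ι ⊕ ι) →L[ℝ] Vec ι)‖ ≤ 1 := by
  refine ContinuousLinearMap.opNorm_le_bound _ zero_le_one fun z => ?_
  rw [one_mul, ← sq_le_sq₀ (norm_nonneg _) (norm_nonneg _), norm_sq_eq_parts z, fstCLM_apply]
  nlinarith [sq_nonneg ‖sndPart z‖]

theorem norm_sndCLM_le : ‖(sndCLM : Vec (ι ⊕ ι) →L[ℝ] Vec ι)‖ ≤ 1 := by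
  refine ContinuousLinearMap.opNorm_le_bound _ zero_le_one fun z => ?_
  rw [one_mul, ← sq_le_sq₀ (norm_nonneg _) (norm_nonneg _), norm_sq_eq_parts z, sndCLM_apply]
  nlinarith [sq_nonneg ‖fstPart z‖]

theorem norm_le_add_parts (z : Vec (ι ⊕ ι)) : ‖z‖ ≤ ‖fstPart z‖ + ‖sndPart z‖ := by
  rw [← sq_le_sq₀ (norm_nonneg _) (by positivity), norm_sq_eq_parts z]
  nlinarith [norm_nonneg (fstPart z), norm_nonneg (sndPart z)]

theorem norm_iteratedFDeriv_comp_clm_le {E F G : Type*} [NormedAddCommGroup E] [NormedSpace ℝ E]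
    [NormedAddCommGroup F] [NormedSpace ℝ F] [NormedAddCommGroup G] [NormedSpace ℝ G]
    (L : E →L[ℝ] F) (hL : ‖L‖ ≤ 1) (f : 𝓢(F, G)) (n : ℕ) (z : E) :
    ‖iteratedFDeriv ℝ n (fun z => f (L z)) z‖ ≤ ‖iteratedFDeriv ℝ n f (L z)‖ := by
  have h := L.iteratedFDeriv_comp_right (f.smooth n) z le_rfl
  change ‖iteratedFDeriv ℝ n (f ∘ L) z‖ ≤ _
  rw [h]
  refine (ContinuousMultilinearMap.norm_compContinuousLinearMap_le _ _).trans ?_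
  rw [Finset.prod_const]
  exact mul_le_of_le_one_right (norm_nonneg _) (pow_le_one₀ (norm_nonneg _) hL)

theorem contDiff_comp_clm {E F G : Type*} [NormedAddCommGroup E] [NormedSpace ℝ E]
    [NormedAddCommGroup F] [NormedSpace ℝ F] [NormedAddCommGroup G] [NormedSpace ℝ G]
    (L : E →L[ℝ] F) (f : 𝓢(F, G)) (n : ℕ∞) : ContDiff ℝ n (fun z => f (L z)) :=
  (f.smooth n).comp L.contDiff

theorem contDiff_tensor (f g : 𝓢(Vec ι, ℂ)) (n : ℕ∞) :
    ContDiff ℝ n (fun z : Vec (ι ⊕ ι) => f (fstCLM z) * g (sndCLM z)) := by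
  have h1 := contDiff_comp_clm (fstCLM (ι := ι)) f n
  have h2 := contDiff_comp_clm (sndCLM (ι := ι)) g n
  exact h1.mul h2

theorem norm_iteratedFDeriv_tensor_le (f g : 𝓢(Vec ι, ℂ)) (n : ℕ) (z : Vec (ι ⊕ ι)) :
    ‖iteratedFDeriv ℝ n (fun z => f (fstCLM z) * g (sndCLM z)) z‖ ≤
      ∑ i ∈ Finset.range (n + 1), (n.choose i : ℝ) *
        ‖iteratedFDeriv ℝ i f (fstCLM z)‖ * ‖iteratedFDeriv ℝ (n - i) g (sndCLM z)‖ := by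
  have h1 := contDiff_comp_clm (fstCLM (ι := ι)) f n
  have h2 := contDiff_comp_clm (sndCLM (ι := ι)) g n
  refine (norm_iteratedFDeriv_mul_le h1 h2 z le_rfl).trans (Finset.sum_le_sum fun i _ => ?_)
  have hf : ‖iteratedFDeriv ℝ i (fun z : Vec (ι ⊕ ι) => f (fstCLM z)) z‖ ≤
      ‖iteratedFDeriv ℝ i f (fstCLM z)‖ :=
    norm_iteratedFDeriv_comp_clm_le (fstCLM (ι := ι)) norm_fstCLM_le f i z
  have hg : ‖iteratedFDeriv ℝ (n - i) (fun z : Vec (ι ⊕ ι) => g (sndCLM z)) z‖ ≤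
      ‖iteratedFDeriv ℝ (n - i) g (sndCLM z)‖ :=
    norm_iteratedFDeriv_comp_clm_le (sndCLM (ι := ι)) norm_sndCLM_le g (n - i) z
  exact mul_le_mul (mul_le_mul_of_nonneg_left hf (Nat.cast_nonneg _)) hg (norm_nonneg _)
    (by positivity)

theorem decay_tensor (f g : 𝓢(Vec ι, ℂ)) (k n : ℕ) : ∃ C : ℝ, ∀ z : Vec (ι ⊕ ι),
    ‖z‖ ^ k * ‖iteratedFDeriv ℝ n (fun z => f (fstCLM z) * g (sndCLM z)) z‖ ≤ C := by
  choose Cf _ hCf using fun i : ℕ => f.decay 0 i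
  choose Cg _ hCg using fun i : ℕ => g.decay 0 i
  choose Df _ hDf using fun i : ℕ => f.decay k i
  choose Dg _ hDg using fun i : ℕ => g.decay k i
  -- Leibniz, together with `|z|^k ≤ 2^(k-1)(|x|^k + |y|^k)`: the weight falls on one factor while
  -- the other is merely bounded. For `k = 0` the truncated exponent is harmless, as the inequality
  -- reads `1 ≤ 2`.
  refine ⟨∑ i ∈ Finset.range (n + 1), (n.choose i : ℝ) *
    (2 ^ (k - 1) * (Df i * Cg (n - i) + Cf i * Dg (n - i))), fun z => ?_⟩
  refine (mul_le_mul_of_nonneg_left (norm_iteratedFDeriv_tensor_le f g n z)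
    (by positivity)).trans ?_
  rw [Finset.mul_sum]
  refine Finset.sum_le_sum fun i _ => ?_
  have h2 : ‖z‖ ^ k ≤ 2 ^ (k - 1) * (‖fstCLM z‖ ^ k + ‖sndCLM z‖ ^ k) :=
    (pow_le_pow_left₀ (norm_nonneg _) (norm_le_add_parts z) k).trans
      (add_pow_le (norm_nonneg _) (norm_nonneg _) k)
  have e1 := hDf i (fstCLM z)
  have e2 := hCf i (fstCLM z)
  have e3 := hDg (n - i) (sndCLM z)
  have e4 := hCg (n - i) (sndCLM z)
  simp only [pow_zero, one_mul] at e2 e4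
  have ha := norm_nonneg (iteratedFDeriv ℝ i f (fstCLM z))
  have hb := norm_nonneg (iteratedFDeriv ℝ (n - i) g (sndCLM z))
  generalize ‖iteratedFDeriv ℝ i f (fstCLM z)‖ = a at *
  generalize ‖iteratedFDeriv ℝ (n - i) g (sndCLM z)‖ = b at *
  calc ‖z‖ ^ k * ((n.choose i : ℝ) * a * b)
      ≤ (2 ^ (k - 1) * (‖fstCLM z‖ ^ k + ‖sndCLM z‖ ^ k)) * ((n.choose i : ℝ) * a * b) :=
        mul_le_mul_of_nonneg_right h2 (by positivity)
    _ = (n.choose i : ℝ) * (2 ^ (k - 1) *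
          ((‖fstCLM z‖ ^ k * a) * b + a * (‖sndCLM z‖ ^ k * b))) := by ring
    _ ≤ _ := by
        refine mul_le_mul_of_nonneg_left (mul_le_mul_of_nonneg_left (add_le_add ?_ ?_)
          (by positivity)) (Nat.cast_nonneg _)
        · exact mul_le_mul e1 e4 hb ((by positivity : (0 : ℝ) ≤ _).trans e1)
        · exact mul_le_mul e2 e3 (by positivity) (ha.trans e2)

/-- The tensor product `(x, y) ↦ f(x) g(y)` of Schwartz functions. -/
def tensorSchwartz (f g : 𝓢(Vec ι, ℂ)) : 𝓢(Vec (ι ⊕ ι), ℂ) where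
  toFun z := f (fstCLM z) * g (sndCLM z)
  smooth' := contDiff_tensor f g ⊤
  decay' := decay_tensor f g

/-- The complex conjugate of a Schwartz function. -/
def conjSchwartz (g : 𝓢(Vec ι, ℂ)) : 𝓢(Vec ι, ℂ) :=
  postcompCLM (𝕜 := ℝ) (Complex.conjCLE : ℂ →L[ℝ] ℂ) g

theorem tensorSchwartz_conj_apply (f g : 𝓢(Vec ι, ℂ)) (z : Vec (ι ⊕ ι)) :
    tensorSchwartz f (conjSchwartz g) z = tensorFun f g z := rfl

theorem tensorConj_toLp (f g : 𝓢(Vec ι, ℂ)) :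
    tensorConj (f.toLp 2 volume) (g.toLp 2 volume) =
      (tensorSchwartz f (conjSchwartz g)).toLp 2 volume := by
  have hfst : Measure.QuasiMeasurePreserving (fstPart : Vec (ι ⊕ ι) → Vec ι) volume volume :=
    Measure.quasiMeasurePreserving_fst.comp measurePreserving_parts.quasiMeasurePreserving
  have hsnd : Measure.QuasiMeasurePreserving (sndPart : Vec (ι ⊕ ι) → Vec ι) volume volume :=
    Measure.quasiMeasurePreserving_snd.comp measurePreserving_parts.quasiMeasurePreserving
  apply Lp.ext
  filter_upwards [(memLp_tensorFun (Lp.memLp (f.toLp 2 volume))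
      (Lp.memLp (g.toLp 2 volume))).coeFn_toLp,
    (tensorSchwartz f (conjSchwartz g)).coeFn_toLp 2 volume,
    hfst.ae_eq_comp (f.coeFn_toLp 2 volume), hsnd.ae_eq_comp (g.coeFn_toLp 2 volume)]
    with z h1 h2 h3 h4
  simp only [Function.comp_apply] at h3 h4
  rw [tensorConj, h1, h2, tensorSchwartz_conj_apply, tensorFun, tensorFun, h3, h4]

/-! ### The Wigner distribution as a metaplectic operator -/

theorem norm_I_cpow (ι : Type*) [Fintype ι] : ‖Complex.I ^ (Fintype.card ι / 2 : ℂ)‖ = 1 := by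
  rw [Complex.norm_cpow_of_ne_zero Complex.I_ne_zero]
  have : ((Fintype.card ι : ℂ) / 2).im = 0 := by
    rw [show (Fintype.card ι : ℂ) / 2 = ((Fintype.card ι / 2 : ℝ) : ℂ) by push_cast; rfl]
    exact Complex.ofReal_im _
  simp [this]

section

variable [DecidableEq ι]

variable (ι) in
/-- The matrix of `(x, t) ↦ (x + t/2, x - t/2)`. -/
def midMatrix : Matrix (ι ⊕ ι) (ι ⊕ ι) ℝ :=
  fromBlocks 1 ((2⁻¹ : ℝ) • 1) 1 (-((2⁻¹ : ℝ) • 1))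

variable (ι) in
/-- The matrix of `(x, y) ↦ ((x + y)/2, x - y)`. -/
def midMatrixInv : Matrix (ι ⊕ ι) (ι ⊕ ι) ℝ :=
  fromBlocks ((2⁻¹ : ℝ) • 1) ((2⁻¹ : ℝ) • 1) 1 (-1)

theorem two_inv_smul_one_add_self {ι : Type*} [DecidableEq ι] :
    (2⁻¹ : ℝ) • (1 : Matrix ι ι ℝ) + (2⁻¹ : ℝ) • 1 = 1 := by
  rw [← add_smul]
  norm_num

theorem midMatrix_mul_inv : midMatrix ι * midMatrixInv ι = 1 := by
  rw [midMatrix, midMatrixInv, fromBlocks_multiply, ← fromBlocks_one]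
  congr 1 <;> simp [two_inv_smul_one_add_self]

/-- The Schur complement of the upper left identity block is `-½I - ½I = -I`. -/
theorem abs_det_midMatrix : |(midMatrix ι).det| = 1 := by
  have h : -((2⁻¹ : ℝ) • (1 : Matrix ι ι ℝ)) - (2⁻¹ : ℝ) • 1 = -1 := by
    rw [← neg_add', two_inv_smul_one_add_self]
  rw [midMatrix, det_fromBlocks_one₁₁, one_mul, h, det_neg]
  simp

theorem abs_det_midMatrixInv : |(midMatrixInv ι).det| = 1 := by
  have h := congrArg (fun M => |Matrix.det M|) (midMatrix_mul_inv (ι := ι))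
  simpa [abs_mul, abs_det_midMatrix] using h

variable (ι) in
/-- The change of variables `(x, t) ↦ (x + t/2, x - t/2)`. -/
def midEquiv : Vec (ι ⊕ ι) ≃L[ℝ] Vec (ι ⊕ ι) :=
  ContinuousLinearEquiv.equivOfInverse (actCLM (midMatrix ι)) (actCLM (midMatrixInv ι))
    (fun z => by
      rw [actCLM_apply, actCLM_apply, act_act, mul_eq_one_comm.1 midMatrix_mul_inv, act_one])
    (fun z => by rw [actCLM_apply, actCLM_apply, act_act, midMatrix_mul_inv, act_one])

theorem midEquiv_apply (z : Vec (ι ⊕ ι)) : midEquiv ι z = act (midMatrix ι) z := rfl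

theorem act_smul_one (c : ℝ) (z : Vec ι) : act (c • (1 : Matrix ι ι ℝ)) z = c • z := by
  ext i
  simp [Matrix.smul_mulVec]

theorem midEquiv_joinParts (x t : Vec ι) :
    midEquiv ι (joinParts x t) = joinParts (x + (2⁻¹ : ℝ) • t) (x - (2⁻¹ : ℝ) • t) := by
  rw [midEquiv_apply, midMatrix]
  refine ext_parts ?_ ?_
  · simp [fstPart_act_fromBlocks, act_one, act_smul_one]
  · simp [sndPart_act_fromBlocks, act_one, act_neg_matrix, act_smul_one, sub_eq_add_neg]

/-- The cross-Wigner distribution of Schwartz functions as a Schwartz function. -/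
def wignerSchwartz (f g : 𝓢(Vec ι, ℂ)) : 𝓢(Vec (ι ⊕ ι), ℂ) :=
  partialFourier (compCLMOfContinuousLinearEquiv ℂ (midEquiv ι)
    (tensorSchwartz f (conjSchwartz g)))

theorem wignerSchwartz_apply (f g : 𝓢(Vec ι, ℂ)) (z : Vec (ι ⊕ ι)) :
    wignerSchwartz f g z = wigner f g z := by
  rw [wignerSchwartz, partialFourier_apply, wigner]
  refine integral_congr_ae (Filter.Eventually.of_forall fun t => ?_)
  simp only [compCLMOfContinuousLinearEquiv_apply, Function.comp_apply, midEquiv_joinParts,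
    tensorSchwartz_conj_apply, tensorFun, fstPart_joinParts, sndPart_joinParts]
  rw [char, inner_neg_left, real_inner_comm]
  congr 2
  push_cast
  simp only [mul_neg]

variable (ι) in
/-- The metaplectic operator with `f ⊗ ḡ ↦ W(f, g)`. -/
def wignerOp : L2 (ι ⊕ ι) ≃ₗᵢ[ℂ] L2 (ι ⊕ ι) :=
  (compAct (midMatrix ι) (midMatrixInv ι) abs_det_midMatrix abs_det_midMatrixInv
    midMatrix_mul_inv).trans <|
  (phaseMul (sndForm ι)).trans <|
  (Lp.fourierTransformₗᵢ (Vec (ι ⊕ ι)) ℂ).trans <|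
  (phaseMul (sndForm ι)).trans <|
  (Lp.fourierTransformₗᵢ (Vec (ι ⊕ ι)) ℂ).symm.trans <|
  (phaseMul (sndForm ι)).trans <|
  constMul (Complex.I ^ (Fintype.card ι / 2 : ℂ)) (norm_I_cpow ι)

theorem compAct_toLp (Φ : 𝓢(Vec (ι ⊕ ι), ℂ)) :
    compAct (midMatrix ι) (midMatrixInv ι) abs_det_midMatrix abs_det_midMatrixInv
      midMatrix_mul_inv (Φ.toLp 2 volume) =
      (compCLMOfContinuousLinearEquiv ℂ (midEquiv ι) Φ).toLp 2 volume := by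
  apply Lp.ext
  filter_upwards [coeFn_compAct abs_det_midMatrix abs_det_midMatrixInv midMatrix_mul_inv
      (Φ.toLp 2 volume),
    (measurePreserving_act (midMatrix ι) abs_det_midMatrix).quasiMeasurePreserving.ae_eq_comp
      (Φ.coeFn_toLp 2 volume),
    (compCLMOfContinuousLinearEquiv ℂ (midEquiv ι) Φ).coeFn_toLp 2 volume] with z h1 h2 h3
  simp only [Function.comp_apply] at h2
  rw [h1, h2, h3]
  rfl

/-- Every factor of `wignerOp` maps Schwartz functions to Schwartz functions, so the `L²` operator
can be evaluated by the pointwise formulas. -/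
theorem wignerOp_tensorConj (f g : 𝓢(Vec ι, ℂ)) :
    wignerOp ι (tensorConj (f.toLp 2 volume) (g.toLp 2 volume)) =
      (wignerSchwartz f g).toLp 2 volume := by
  simp only [wignerOp, LinearIsometryEquiv.trans_apply, tensorConj_toLp, compAct_toLp,
    phaseMul_toLp, fourierTransform_toLp, fourierTransform_symm_toLp, constMul_apply]
  exact ((toLpCLM (E := Vec (ι ⊕ ι)) ℂ ℂ 2 volume).map_smul _ _).symm

/-- The operator `μ(A)` for a covariant matrix: the Wigner transform followed by the Fourier
multiplier `phase B`. -/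
def cohenOp (B : Matrix (ι ⊕ ι) (ι ⊕ ι) ℝ) : L2 (ι ⊕ ι) ≃ₗᵢ[ℂ] L2 (ι ⊕ ι) :=
  (wignerOp ι).trans <| (Lp.fourierTransformₗᵢ (Vec (ι ⊕ ι)) ℂ).trans <|
    (phaseMul B).trans (Lp.fourierTransformₗᵢ (Vec (ι ⊕ ι)) ℂ).symm

theorem isWignerConv_cohenOp (B : Matrix (ι ⊕ ι) (ι ⊕ ι) ℝ) :
    IsWignerConv (fun f g : 𝓢(Vec ι, ℂ) =>
      metaWigner (cohenOp B) (f.toLp 2 volume) (g.toLp 2 volume)) (𝓕⁻ (phaseDistribution B)) := by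
  intro f g
  refine ⟨wignerSchwartz f g, wignerSchwartz_apply f g, ?_⟩
  simp only [metaWigner, cohenOp, LinearIsometryEquiv.trans_apply, wignerOp_tensorConj,
    phaseMul_toLp, fourierTransform_toLp, fourierTransform_symm_toLp]
  filter_upwards [(𝓕⁻ (smulLeftCLM ℂ (phase B) (𝓕 (wignerSchwartz f g)))).coeFn_toLp 2 volume]
    with z hz
  rw [hz, conv_fourierInv_phaseDistribution]

theorem fourier_matrix_mul_inv :
    (fromBlocks 0 1 (-1) 0 : Matrix (ι ⊕ ι) (ι ⊕ ι) ℝ) * fromBlocks 0 (-1) 1 0 = 1 := by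
  rw [fromBlocks_multiply, ← fromBlocks_one]
  simp

theorem sndForm_transpose {ι : Type*} [DecidableEq ι] : (sndForm ι)ᵀ = sndForm ι := by
  simp [sndForm, fromBlocks_transpose]

/-- This projection is the covariant matrix with `A₁₁ = ½I` and `A₁₃ = A₂₁ = 0`, the case `B = 0`.
-/
theorem isMetaplectic_wignerOp :
    IsMetaplectic (fromBlocks (fromBlocks ((2⁻¹ : ℝ) • 1) ((2⁻¹ : ℝ) • 1) 0 0)
      (fromBlocks 0 0 ((2⁻¹ : ℝ) • 1) (-((2⁻¹ : ℝ) • 1)))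
      (fromBlocks 0 0 (-1) 1) (fromBlocks 1 1 0 0)) (wignerOp ι) := by
  have hC := isMetaplectic_phaseMul (sndForm ι) sndForm_transpose
  have hF := isMetaplectic_fourier (ι := ι ⊕ ι)
  have h := (isMetaplectic_compAct (abs_det_midMatrix (ι := ι)) (abs_det_midMatrixInv (ι := ι))
    midMatrix_mul_inv).trans (hC.trans (hF.trans (hC.trans ((hF.symm fourier_matrix_mul_inv).trans
      (hC.trans (isMetaplectic_constMul _ (norm_I_cpow ι)))))))
  convert! h using 1
  simp only [one_mul, fromBlocks_multiply, zero_mul, mul_zero, mul_one, add_zero, zero_add,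
    mul_neg, sndForm, midMatrix, midMatrixInv, fromBlocks_transpose, neg_neg, fromBlocks_neg,
    neg_zero, fromBlocks_add, ← fromBlocks_one (l := ι) (m := ι)]
  simp

/-- Fourier conjugation turns `(I, 0; -B, I)` into `(I, B; 0, I)`. Multiplying the Wigner projection
by it keeps the lower block rows, which all covariant matrices share, and adds `B` times them to the
upper ones. -/
theorem isMetaplectic_cohenOp (A11 A13 A21 : Matrix ι ι ℝ) (h13 : A13ᵀ = A13) (h21 : A21ᵀ = A21) :
    IsMetaplectic (covariantMatrix A11 A13 A21) (cohenOp (cohenMatrix A11 A13 A21)) := by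
  have hB : (cohenMatrix A11 A13 A21)ᵀ = cohenMatrix A11 A13 A21 := by
    simp [cohenMatrix, fromBlocks_transpose, h13, h21]
  have hF := isMetaplectic_fourier (ι := ι ⊕ ι)
  have h := isMetaplectic_wignerOp.trans (hF.trans ((isMetaplectic_phaseMul _ hB).trans
    (hF.symm fourier_matrix_mul_inv)))
  convert! h using 1
  simp only [one_mul, fromBlocks_multiply, zero_mul, mul_zero, mul_one, add_zero, zero_add,
    neg_mul, mul_neg, covariantMatrix, cohenMatrix, neg_neg, fromBlocks_add, neg_zero, neg_sub]
  have h1 : (2⁻¹ : ℝ) • (1 : Matrix ι ι ℝ) + ((2⁻¹ : ℝ) • 1 - A11) = 1 - A11 := by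
    rw [← add_sub_assoc, two_inv_smul_one_add_self]
  have h2 : (2⁻¹ : ℝ) • (1 : Matrix ι ι ℝ) + ((2⁻¹ : ℝ) • 1 - A11ᵀ) = 1 - A11ᵀ := by
    rw [← add_sub_assoc, two_inv_smul_one_add_self]
  have h3 : (2⁻¹ : ℝ) • (1 : Matrix ι ι ℝ) + (A11 - (2⁻¹ : ℝ) • 1) = A11 := add_sub_cancel _ _
  have h4 : -((2⁻¹ : ℝ) • (1 : Matrix ι ι ℝ)) + ((2⁻¹ : ℝ) • 1 - A11ᵀ) = -A11ᵀ := by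
    rw [← add_sub_assoc, neg_add_cancel, zero_sub]
  rw [h1, h2, h3, h4]

end

/-- Two metaplectic operators with the same projection differ by a phase factor. -/
theorem IsMetaplectic.exists_smul_eq {A : Matrix (ι ⊕ ι) (ι ⊕ ι) ℝ} {U₀ U : L2 ι ≃ₗᵢ[ℂ] L2 ι}
    (h₀ : IsMetaplectic A U₀) (h : IsMetaplectic A U) :
    ∃ c : ℂ, ‖c‖ = 1 ∧ ∀ F, U F = c • U₀ F := by
  -- `U₀⁻¹U` commutes with the representation because both operators carry `ρ(z)` to `ρ(Az)`.
  obtain ⟨c, hc, hV⟩ := exists_eq_smul_of_commute (V := U.trans U₀.symm) fun z F => by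
    rw [LinearIsometryEquiv.trans_apply, LinearIsometryEquiv.trans_apply,
      LinearIsometryEquiv.symm_apply_eq, h, h₀, U₀.apply_symm_apply]
  refine ⟨c, hc, fun F => ?_⟩
  rw [← map_smul, ← hV F, LinearIsometryEquiv.trans_apply, U₀.apply_symm_apply]

theorem IsWignerConv.smul {Q : 𝓢(Vec ι, ℂ) → 𝓢(Vec ι, ℂ) → L2 (ι ⊕ ι)}
    {S : 𝓢'(Vec (ι ⊕ ι), ℂ)} (h : IsWignerConv Q S) (c : ℂ) :
    IsWignerConv (fun f g => c • Q f g) (c • S) := by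
  intro f g
  obtain ⟨w, hw, hQ⟩ := h f g
  refine ⟨w, hw, ?_⟩
  filter_upwards [hQ, Lp.coeFn_smul c (Q f g)] with z h1 h2
  rw [h2, Pi.smul_apply, h1]
  rfl

end CohenKernel

end

/-! ### The main theorem -/

theorem theorem4p10 (d : ℕ)
    (A : Matrix ((Fin d ⊕ Fin d) ⊕ (Fin d ⊕ Fin d)) ((Fin d ⊕ Fin d) ⊕ (Fin d ⊕ Fin d)) ℝ)
    (hA : A ∈ Matrix.symplecticGroup (Fin d ⊕ Fin d) ℝ)
    (A11 A13 A21 : Matrix (Fin d) (Fin d) ℝ)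
    (h13 : A13ᵀ = A13) (h21 : A21ᵀ = A21)
    (hblock : A = CohenKernel.covariantMatrix A11 A13 A21) :
    -- for a suitable choice of the phase of `μ(A)`, `W_A(f, g) = W(f, g) ∗ Σ_A`
    (∃ U : CohenKernel.L2 (Fin d ⊕ Fin d) ≃ₗᵢ[ℂ] CohenKernel.L2 (Fin d ⊕ Fin d),
      CohenKernel.IsMetaplectic A U ∧
      CohenKernel.IsWignerConv
        (fun f g => CohenKernel.metaWigner U (f.toLp 2 volume) (g.toLp 2 volume))
        (CohenKernel.cohenKernel A11 A13 A21)) ∧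
    -- every choice of `μ(A)` gives this up to a constant phase factor, and is of Cohen class
    (∀ U : CohenKernel.L2 (Fin d ⊕ Fin d) ≃ₗᵢ[ℂ] CohenKernel.L2 (Fin d ⊕ Fin d),
      CohenKernel.IsMetaplectic A U →
      (∃ c : ℂ, ‖c‖ = 1 ∧
        CohenKernel.IsWignerConv
          (fun f g => c • CohenKernel.metaWigner U (f.toLp 2 volume) (g.toLp 2 volume))
          (CohenKernel.cohenKernel A11 A13 A21)) ∧
      CohenKernel.IsCohenClass
        (fun f g => CohenKernel.metaWigner U (f.toLp 2 volume) (g.toLp 2 volume))) := by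
  subst hblock
  have h₀ := CohenKernel.isMetaplectic_cohenOp A11 A13 A21 h13 h21
  have hconv := CohenKernel.isWignerConv_cohenOp (CohenKernel.cohenMatrix A11 A13 A21)
  refine ⟨⟨_, h₀, hconv⟩, fun U hU => ?_⟩
  obtain ⟨c, hc, h⟩ := h₀.exists_smul_eq hU
  have hc0 : c ≠ 0 := by
    rintro rfl
    simp at hc
  -- Here `U = c U₀`, so `c⁻¹` restores the good phase.
  refine ⟨⟨c⁻¹, by rw [norm_inv, hc, inv_one], ?_⟩, ?_⟩
  · convert! hconv using 3
    rw [CohenKernel.metaWigner, h, inv_smul_smul₀ hc0, CohenKernel.metaWigner]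
  -- For Cohen class membership the phase is absorbed into the kernel instead.
  · refine ⟨c • 𝓕⁻ (CohenKernel.phaseDistribution (CohenKernel.cohenMatrix A11 A13 A21)), ?_⟩
    convert! hconv.smul c using 3
    rw [CohenKernel.metaWigner, h, CohenKernel.metaWigner]
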